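/- Let $\mathbb T^2=\mathbb R^2/\mathbb Z^2$, $\nu>0$, $T>0$. Let $\mathbb H\subset L^2(\mathbb T^2)^2$ be the space of fields orthogonal to all gradients $\nabla q$, $q\in H^1(\mathbb T^2)$, let $\mathbb V=\{v\in H^1(\mathbb T^2)^2:\operatorname{div}v=0\}$, $Q=\{q\in L^2(\mathbb T^2):\int q=0\}$, and write $(\cdot,\cdot)$ for the $L^2$ inner product. On a filtered probability space let $W=\sum_k W_k e_k$ be a cylindrical Wiener process, where $(e_k)$ is a countable orthonormal basis of a Hilbert space $\mathfrak U$ and the $W_k$ are mutually independent standard Wiener processes relative to the filtration. Let $\Phi:\mathfrak U\to \mathbb H\cap H^3(\mathbb T^2)^2$ be a Hilbert–Schmidt operator (solenoidal noise), $\Phi W(t)=\sum_k W_k(t)\Phi e_k$, and let $u_0\in L^2(\Omega;\mathbb H\cap H^3(\mathbb T^2)^2)$ be $\mathfrak F_0$-measurable. Consider the linear stochastic Stokes system $$du+[\nabla p-\nu\Delta u]\,dt=\Phi\,dW,\qquad \operatorname{div}u=0,\qquad u(0)=u_0,$$ whose weak pathwise solution $u$ on $[0,T]$ is adapted, lies almost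 surely in $C([0,T];\mathbb H)\cap L^2(0,T;\mathbb V)$, and satisfies almost surely, for all $\varphi\in\mathbb V$ and $t\in[0,T]$, $$(u(t),\varphi)-(u_0,\varphi)=-\nu\int_0^t(\nabla u(s),\nabla\varphi)\,ds+(\Phi W(t),\varphi).$$ Let $N\ge1$ be an integer, $\tau=T/N$, $t_n=n\tau$, and let $M\ge \tau^{-1}$ be an integer (for instance $M=\tau^{-1}$ if this is an integer; the fine mesh then has size $\tau^2$). Put $$I_n=\frac1M\sum_{\ell=1}^M W\Big(t_n+\ell\frac{\tau}{M}\Big),\qquad J_n=I_n-\tfrac12\big(W(t_{n+1})+W(t_n)\big).$$ The Crank–Nicolson scheme is: with first iterate $u_0$, for $n=0,\dots,N-1$ find $(u_{n+1},p_{n+1})\in H^1(\mathbb T^2)^2\times Q$ such that almost surely, for all $(\varphi,q)\in H^1(\mathbb T^2)^2\times Q$, $$\Big(\frac{u_{n+1}-u_n}{\tau},\varphi\Big)+\nu\big(\nabla(u^{n+1/2}+\Phi J_n),\nabla\varphi\big)-(p_{n+1},\operatorname{div}\varphi)=\Big(\frac{\Phi W(t_{n+1})-\Phi W(t_n)}{\tau},\varphi\Big),\qquad(\operatorname{div}u_{n+1},q)=0,$$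 where $u^{n+1/2}=\frac12(u_n+u_{n+1})$. Then there is a constant $C>0$, independent of $\tau$, $N$ and $M$, such that, with $u(t_{n+1/2}):=\frac12(u(t_n)+u(t_{n+1}))$, $$\max_{0\le n\le N}\mathbb E\|u(t_n)-u_n\|_{L^2}^2\le C\tau^3\qquad\text{and}\qquad \nu\,\tau\sum_{n=0}^{N-1}\mathbb E\|\nabla(u(t_{n+1/2})-u^{n+1/2})\|_{L^2}^2\le C\tau^3 .$$ -/

import Mathlib

open MeasureTheory ProbabilityTheory
open scoped NNReal ENNReal

noncomputable section

namespace StochasticStokes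

/-! ### The torus, Lebesgue spaces and Sobolev spaces -/

/-- The two-dimensional flat torus `ℝ² / ℤ²`. -/
abbrev Torus : Type := UnitAddTorus (Fin 2)

/-- The Lebesgue measure of the torus, which has total mass one. -/
abbrev torusMeasure : Measure Torus := Measure.pi fun _ => AddCircle.haarAddCircle

/-- The values of velocity fields: `ℝ²` with its Euclidean norm. -/
abbrev Vec : Type := EuclideanSpace ℝ (Fin 2)

/-- Square-integrable functions on the torus with values in `F`. -/
abbrev LTwo (F : Type) [NormedAddCommGroup F] : Type := Lp F 2 torusMeasure

/-- A function on the torus is smooth if its periodic lift to `ℝ²` is smooth. -/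
def IsSmooth (φ : Torus → ℝ) : Prop :=
  ContDiff ℝ ((⊤ : ℕ∞) : WithTop ℕ∞) fun x : Fin 2 → ℝ => φ fun i => (x i : UnitAddCircle)

/-- The classical partial derivative in the `i`-th coordinate direction. -/
def partialDeriv (i : Fin 2) (φ : Torus → ℝ) (x : Torus) : ℝ :=
  deriv (fun h : ℝ => φ (x + Pi.single i (h : UnitAddCircle))) 0

variable {F : Type} [NormedAddCommGroup F] [NormedSpace ℝ F]

/-- `g` is the `i`-th weak partial derivative of `v`. -/
def HasWeakPartial (i : Fin 2) (v g : LTwo F) : Prop :=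
  ∀ φ : Torus → ℝ, IsSmooth φ →
    ∫ x, partialDeriv i φ x • v x ∂torusMeasure = -∫ x, φ x • g x ∂torusMeasure

/-- The square of the norm of the Sobolev space `H^k`, that is
`‖v‖²_{H^0} = ‖v‖²` and `‖v‖²_{H^(k+1)} = ‖v‖² + ∑ i, ‖∂ᵢ v‖²_{H^k}`.
It is infinite if a weak derivative that is needed does not exist in `L²`. -/
def sobolevSq : ℕ → LTwo F → ℝ≥0∞
  | 0, v => ‖v‖ₑ ^ 2
  | k + 1, v => ‖v‖ₑ ^ 2 + ∑ i : Fin 2, ⨅ (g : LTwo F) (_ : HasWeakPartial i v g), sobolevSq k g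

/-- Membership in the Sobolev space `H^k`. -/
def MemSobolev (k : ℕ) (v : LTwo F) : Prop := sobolevSq k v < ∞

/-- `‖∇ v‖²` in `L²`; infinite if `v` is not in `H¹`. -/
def gradSq (v : LTwo F) : ℝ≥0∞ :=
  ∑ i : Fin 2, ⨅ (g : LTwo F) (_ : HasWeakPartial i v g), ‖g‖ₑ ^ 2

open Classical in
/-- The `i`-th weak partial derivative as an operator; it is only used for `v` in `H¹`. -/
def weakPartial (i : Fin 2) (v : LTwo F) : LTwo F :=
  if h : ∃ g, HasWeakPartial i v g then h.choose else 0

/-- The `i`-th component of a square-integrable velocity field. -/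
def component (i : Fin 2) (v : LTwo Vec) : LTwo ℝ :=
  (EuclideanSpace.proj i : Vec →L[ℝ] ℝ).compLp v

/-- `(∇ v, ∇ w)`, the `L²` inner product of the gradients, for `v`, `w` in `H¹`. -/
def gradInner (v w : LTwo Vec) : ℝ :=
  ∑ i : Fin 2, inner ℝ (weakPartial i v) (weakPartial i w)

/-- The divergence of a velocity field in `H¹`. -/
def divergence (v : LTwo Vec) : LTwo ℝ :=
  ∑ i : Fin 2, component i (weakPartial i v)

/-- The space `ℍ`: square-integrable fields that are orthogonal to all gradients of
functions in `H¹`. -/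
def IsSolenoidal (v : LTwo Vec) : Prop :=
  ∀ q : LTwo ℝ, MemSobolev 1 q → ∑ i : Fin 2, inner ℝ (component i v) (weakPartial i q) = 0

/-- The space `𝕍`: divergence-free fields in `H¹`. -/
def MemV (v : LTwo Vec) : Prop := MemSobolev 1 v ∧ divergence v = 0

/-- The space of pressures: square-integrable functions with mean value zero. -/
def IsPressure (q : LTwo ℝ) : Prop := ∫ x, q x ∂torusMeasure = 0

/-! ### The cylindrical Wiener process and the noise -/

variable {Ω : Type*} {mΩ : MeasurableSpace Ω}
variable {ι : Type*} {H : Type*} [NormedAddCommGroup H] [InnerProductSpace ℝ H]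

/-- The coordinates `W k` of a cylindrical Wiener process: mutually independent real
standard Wiener processes relative to the filtration `𝓕`. -/
structure IsCylindricalWiener (𝓕 : Filtration ℝ≥0 mΩ) (P : Measure Ω)
    (W : ι → ℝ≥0 → Ω → ℝ) : Prop where
  brownian : ∀ k, IsBrownianReal (W k) P
  adapted : ∀ k t, Measurable[𝓕 t] (W k t)
  indep_increments : ∀ k s t, s ≤ t →
    Indep (MeasurableSpace.comap (fun ω => W k t ω - W k s ω) inferInstance) (𝓕 s) P
  indep : iIndepFun (fun k ω (t : ℝ≥0) => W k t ω) P

open Classical in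
/-- The random field `W k t • Φ (e k)` as an element of `L²(Ω; L²)`. -/
def noiseTerm (P : Measure Ω) (e : HilbertBasis ι ℝ H) (Φ : H →L[ℝ] LTwo Vec)
    (W : ι → ℝ≥0 → Ω → ℝ) (t : ℝ≥0) (k : ι) : Lp (LTwo Vec) 2 P :=
  if h : MemLp (fun ω => W k t ω • Φ (e k)) 2 P then h.toLp else 0

/-- The noise `Φ W(t) = ∑ₖ W k t • Φ (e k)`, where the series converges in `L²(Ω; L²)`. -/
def noise (P : Measure Ω) (e : HilbertBasis ι ℝ H) (Φ : H →L[ℝ] LTwo Vec)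
    (W : ι → ℝ≥0 → Ω → ℝ) (t : ℝ≥0) : Ω → LTwo Vec :=
  ⇑(∑' k, noiseTerm P e Φ W t k)

/-! ### The stochastic Stokes system -/

/-- `u` is a weak pathwise solution on `[0, T]` of
`du + (∇p - ν Δu) dt = Φ dW`, `div u = 0`, `u(0) = u₀`.
The pressure is eliminated by testing with divergence-free fields. -/
structure IsStokesSolution (𝓕 : Filtration ℝ≥0 mΩ) (P : Measure Ω)
    (e : HilbertBasis ι ℝ H) (Φ : H →L[ℝ] LTwo Vec) (W : ι → ℝ≥0 → Ω → ℝ)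
    (ν : ℝ) (T : ℝ≥0) (u₀ : Ω → LTwo Vec) (u : ℝ≥0 → Ω → LTwo Vec) : Prop where
  adapted : ∀ t ≤ T, StronglyMeasurable[𝓕 t] (u t)
  continuous_paths : ∀ᵐ ω ∂P, ContinuousOn (fun t => u t ω) (Set.Icc 0 T)
  solenoidal : ∀ᵐ ω ∂P, ∀ t ≤ T, IsSolenoidal (u t ω)
  mem_L2_V : ∀ᵐ ω ∂P, ∫⁻ s in Set.Icc (0 : ℝ) T, sobolevSq 1 (u s.toNNReal ω) < ∞
  initial : u 0 =ᵐ[P] u₀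
  momentum : ∀ t ≤ T, ∀ φ : LTwo Vec, MemV φ → ∀ᵐ ω ∂P,
    inner ℝ (u t ω) φ - inner ℝ (u₀ ω) φ =
      -(ν * ∫ s in (0 : ℝ)..t, gradInner (u s.toNNReal ω) φ) +
        inner ℝ (noise P e Φ W t ω) φ

/-! ### The Crank–Nicolson scheme -/

/-- `Φ Iₙ`, where `Iₙ` is the average of `W(tₙ + ℓ τ / M)` over `ℓ = 1, …, M`, with `tₙ = n τ`.
For `M = 1 / τ` the fine mesh has size `τ²` and `Iₙ = ∑ ℓ, τ W(tₙ + ℓ τ²)`. -/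
def noiseQuadrature (P : Measure Ω) (e : HilbertBasis ι ℝ H) (Φ : H →L[ℝ] LTwo Vec)
    (W : ι → ℝ≥0 → Ω → ℝ) (τ : ℝ≥0) (M n : ℕ) (ω : Ω) : LTwo Vec :=
  (M : ℝ)⁻¹ • ∑ ℓ ∈ Finset.Icc 1 M, noise P e Φ W (n * τ + ℓ * (τ / M)) ω

/-- `Φ Jₙ` with the quadrature correction `Jₙ = Iₙ - (W(tₙ₊₁) + W(tₙ)) / 2`. -/
def quadratureCorrection (P : Measure Ω) (e : HilbertBasis ι ℝ H) (Φ : H →L[ℝ] LTwo Vec)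
    (W : ι → ℝ≥0 → Ω → ℝ) (τ : ℝ≥0) (M n : ℕ) (ω : Ω) : LTwo Vec :=
  noiseQuadrature P e Φ W τ M n ω -
    (2⁻¹ : ℝ) • (noise P e Φ W ((n + 1 : ℕ) * τ) ω + noise P e Φ W (n * τ) ω)

/-- `(U n, p n)`, `n ≤ N`, are iterates of the Crank–Nicolson scheme for the stochastic Stokes
system with step size `τ`. -/
structure IsCrankNicolson (P : Measure Ω)
    (e : HilbertBasis ι ℝ H) (Φ : H →L[ℝ] LTwo Vec) (W : ι → ℝ≥0 → Ω → ℝ)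
    (ν : ℝ) (τ : ℝ≥0) (N M : ℕ) (u₀ : Ω → LTwo Vec)
    (U : ℕ → Ω → LTwo Vec) (p : ℕ → Ω → LTwo ℝ) : Prop where
  initial : U 0 =ᵐ[P] u₀
  mem_H1 : ∀ n < N, ∀ᵐ ω ∂P, MemSobolev 1 (U (n + 1) ω)
  mem_Q : ∀ n < N, ∀ᵐ ω ∂P, IsPressure (p (n + 1) ω)
  momentum : ∀ n < N, ∀ᵐ ω ∂P, ∀ φ : LTwo Vec, MemSobolev 1 φ →
    inner ℝ ((τ : ℝ)⁻¹ • (U (n + 1) ω - U n ω)) φ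
      + ν * gradInner ((2⁻¹ : ℝ) • (U (n + 1) ω + U n ω)
          + quadratureCorrection P e Φ W τ M n ω) φ
      - inner ℝ (p (n + 1) ω) (divergence φ)
    = inner ℝ ((τ : ℝ)⁻¹ • (noise P e Φ W ((n + 1 : ℕ) * τ) ω - noise P e Φ W (n * τ) ω)) φ
  incompressible : ∀ n < N, ∀ᵐ ω ∂P, ∀ q : LTwo ℝ, IsPressure q →
    inner ℝ (divergence (U (n + 1) ω)) q = 0

end StochasticStokes

end

open StochasticStokes

/-! On the torus the Stokes operator is diagonal in Fourier space. The fields `mode ξ j b` are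
divergence-free trigonometric eigenfields of `-Δ`, so testing with them removes the pressure and
turns both the equation and the scheme into independent scalar problems. They are redundant, but
they satisfy Parseval's identity on solenoidal fields (`energy_eq_sum_mode`), so scalar error bounds
add up to norms.

In one mode, with `a = ν * eigen ξ`, the coefficient obeys `dx = -a x dt + dy`, where `y` has
covariance `σ min(s,t)`. The path `y` is recovered from `x` as `drive a x`, so no stochastic
integral is needed. Although `x` is rough, `x - y` is continuously differentiable with derivative
`-a x`. The correction `J` makes the scheme apply the trapezoidal rule only to `x - y`, while `y` is
integrated by the fine quadrature. The local defect is therefore `a ∫ (s - midpoint)(x - c)` plus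
the quadrature error, for any constant `c` (`trapezoid_identity`).

The quadrature error is a sum of cell errors that are pairwise uncorrelated, whence its second
moment is at most `σ τ (τ/M)²`, which is at most `σ τ⁵` because `M ≥ 1/τ`
(`ModeProcess.lintegral_quadrature_sq`). The other term needs `E ∫ |x - c|² = O(τ)` uniformly in
`a`: for stiff modes, `a τ ≥ 1`, damping makes `c = 0` good enough, and otherwise the left endpoint
values serve (`ModeProcess.exists_integral_sq_sub_le`). Crank–Nicolson stability (`energy_estimate`)
bounds the error by `a/τ` times the sum of the squared defects, which gives `τ³ (a³ (m + T σ) + a T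
σ)` up to constants (`ModeProcess.lintegral_error_le`).

The weight `a³` is exactly what `H³` data pay for: summed over the modes, `eigen³ m` and `eigen³ σ`
are controlled by the `H³` moment of `u₀` and the Hilbert–Schmidt norm of `Φ` into `H³`
(`tsum_mode_bound_le`). -/

noncomputable section

namespace StochasticStokes

/-! ### Integration by parts on the torus -/

open UnitAddTorus

/-- The quotient map from the plane to the torus. -/
def toTorus (x : Fin 2 → ℝ) : Torus := fun i => (x i : UnitAddCircle)

lemma isOpenQuotientMap_toTorus : IsOpenQuotientMap toTorus := by
  have : ∀ i : Fin 2, IsOpenQuotientMap (fun x : ℝ => (x : UnitAddCircle)) := fun _ =>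
    QuotientAddGroup.isOpenQuotientMap_mk
  exact IsOpenQuotientMap.piMap this

lemma toTorus_add (x y : Fin 2 → ℝ) : toTorus (x + y) = toTorus x + toTorus y := by
  ext i; simp [toTorus]

lemma toTorus_single (i : Fin 2) (h : ℝ) :
    toTorus (Pi.single i h) = Pi.single i (h : UnitAddCircle) := by
  ext j
  by_cases hj : j = i
  · subst hj; simp [toTorus]
  · simp [toTorus, hj]

lemma isSmooth_iff {φ : Torus → ℝ} :
    IsSmooth φ ↔ ContDiff ℝ ((⊤ : ℕ∞) : WithTop ℕ∞) (φ ∘ toTorus) := Iff.rfl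

lemma IsSmooth.mul {φ ψ : Torus → ℝ} (hφ : IsSmooth φ) (hψ : IsSmooth ψ) :
    IsSmooth (fun x => φ x * ψ x) := ContDiff.mul (isSmooth_iff.1 hφ) (isSmooth_iff.1 hψ)

lemma IsSmooth.continuous {φ : Torus → ℝ} (hφ : IsSmooth φ) : Continuous φ :=
  isOpenQuotientMap_toTorus.isQuotientMap.continuous_iff.2 (isSmooth_iff.1 hφ).continuous

lemma IsSmooth.hasDerivAt {φ : Torus → ℝ} (hφ : IsSmooth φ) (i : Fin 2) (y : Fin 2 → ℝ) (h₀ : ℝ) :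
    HasDerivAt (fun h : ℝ => φ (toTorus y + Pi.single i (h : UnitAddCircle)))
      (fderiv ℝ (φ ∘ toTorus) (y + Pi.single i h₀) (Pi.single i 1)) h₀ := by
  have h1 : HasDerivAt (fun h : ℝ => y + Pi.single i h) (Pi.single i 1) h₀ :=
    (hasDerivAt_single i h₀).const_add y
  have h2 := ((isSmooth_iff.1 hφ).differentiable (by simp) (y + Pi.single i h₀)).hasFDerivAt
  have h3 := h2.comp_hasDerivAt h₀ h1
  refine h3.congr_of_eventuallyEq (Filter.Eventually.of_forall fun h => ?_)
  simp [toTorus_add, toTorus_single]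

lemma IsSmooth.partialDeriv_toTorus {φ : Torus → ℝ} (hφ : IsSmooth φ) (i : Fin 2)
    (y : Fin 2 → ℝ) :
    partialDeriv i φ (toTorus y) = fderiv ℝ (φ ∘ toTorus) y (Pi.single i 1) := by
  have h := (hφ.hasDerivAt i y 0).deriv
  rw [Pi.single_zero, add_zero] at h
  exact h

lemma IsSmooth.partialDeriv {φ : Torus → ℝ} (hφ : IsSmooth φ) (i : Fin 2) :
    IsSmooth (partialDeriv i φ) := by
  rw [isSmooth_iff]
  have : StochasticStokes.partialDeriv i φ ∘ toTorus =
      fun y => fderiv ℝ (φ ∘ toTorus) y (Pi.single i 1) :=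
    funext fun y => hφ.partialDeriv_toTorus i y
  rw [this]
  exact ((isSmooth_iff.1 hφ).fderiv_right (m := ((⊤ : ℕ∞) : WithTop ℕ∞)) (by simp)).clm_apply
    contDiff_const

lemma IsSmooth.hasDerivAt_partialDeriv {φ : Torus → ℝ} (hφ : IsSmooth φ) (i : Fin 2) (x : Torus)
    (h₀ : ℝ) :
    HasDerivAt (fun h : ℝ => φ (x + Pi.single i (h : UnitAddCircle)))
      (StochasticStokes.partialDeriv i φ (x + Pi.single i (h₀ : UnitAddCircle))) h₀ := by
  obtain ⟨y, rfl⟩ := isOpenQuotientMap_toTorus.surjective x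
  rw [← toTorus_single, ← toTorus_add, hφ.partialDeriv_toTorus]
  exact hφ.hasDerivAt i y h₀

lemma IsSmooth.partialDeriv_mul {φ ψ : Torus → ℝ} (hφ : IsSmooth φ) (hψ : IsSmooth ψ) (i : Fin 2)
    (x : Torus) : StochasticStokes.partialDeriv i (fun x => φ x * ψ x) x =
      StochasticStokes.partialDeriv i φ x * ψ x + φ x * StochasticStokes.partialDeriv i ψ x := by
  have := ((hφ.hasDerivAt_partialDeriv i x 0).mul (hψ.hasDerivAt_partialDeriv i x 0)).deriv
  simpa [StochasticStokes.partialDeriv] using! this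

lemma _root_.Continuous.integrable_torus {E : Type*} [NormedAddCommGroup E] {f : Torus → E}
    (hf : Continuous f) : Integrable f torusMeasure :=
  integrableOn_univ.1 (hf.continuousOn.integrableOn_compact isCompact_univ)

lemma _root_.Continuous.memLp_torus {E : Type*} [NormedAddCommGroup E] [SecondCountableTopology E]
    {f : Torus → E} (hf : Continuous f) (p : ℝ≥0∞) : MemLp f p torusMeasure := by
  obtain ⟨C, hC⟩ := isCompact_univ.exists_bound_of_continuousOn hf.continuousOn
  exact MemLp.of_bound hf.aestronglyMeasurable C (by simpa using Filter.Eventually.of_forall hC)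

/-- Haar measure is translation invariant, so the integral of the translate of `φ` by `h` does not
depend on `h`; differentiate under the integral at `h = 0`. -/
lemma integral_partialDeriv {φ : Torus → ℝ} (hφ : IsSmooth φ) (i : Fin 2) :
    ∫ x, partialDeriv i φ x ∂torusMeasure = 0 := by
  have hc : Continuous (partialDeriv i φ) := (hφ.partialDeriv i).continuous
  have hs : ∀ h : ℝ, Continuous fun x : Torus => x + Pi.single i (h : UnitAddCircle) :=
    fun h => by fun_prop
  have h1 : ∀ h : ℝ, Continuous fun x : Torus => φ (x + Pi.single i (h : UnitAddCircle)) :=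
    fun h => hφ.continuous.comp (hs h)
  have h1' : ∀ h : ℝ, Continuous fun x : Torus =>
      partialDeriv i φ (x + Pi.single i (h : UnitAddCircle)) := fun h => hc.comp (hs h)
  obtain ⟨C, hC⟩ := isCompact_univ.exists_bound_of_continuousOn hc.continuousOn
  have h2 : HasDerivAt
      (fun h : ℝ => ∫ x, φ (x + Pi.single i (h : UnitAddCircle)) ∂torusMeasure)
      (∫ x, partialDeriv i φ (x + Pi.single i ((0 : ℝ) : UnitAddCircle)) ∂torusMeasure) 0 :=
    (hasDerivAt_integral_of_dominated_loc_of_deriv_le (s := Set.univ) (bound := fun _ => C)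
      Filter.univ_mem
      (Filter.Eventually.of_forall fun h => (h1 h).aestronglyMeasurable)
      (h1 0).integrable_torus (h1' 0).aestronglyMeasurable
      (Filter.Eventually.of_forall fun x h _ => hC _ (Set.mem_univ _))
      (integrable_const _)
      (Filter.Eventually.of_forall fun x h _ => hφ.hasDerivAt_partialDeriv i x h)).2
  have h3 : (fun h : ℝ => ∫ x, φ (x + Pi.single i (h : UnitAddCircle)) ∂torusMeasure) =
      fun _ => ∫ x, φ x ∂torusMeasure :=
    funext fun h => integral_add_right_eq_self φ _
  rw [h3] at h2
  have h4 := h2.unique (hasDerivAt_const _ _)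
  rw [← h4]
  congr 1
  funext x
  rw [AddCircle.coe_zero, Pi.single_zero, add_zero]

lemma integral_partialDeriv_mul {φ ψ : Torus → ℝ} (hφ : IsSmooth φ) (hψ : IsSmooth ψ)
    (i : Fin 2) :
    ∫ x, partialDeriv i φ x * ψ x ∂torusMeasure = -∫ x, φ x * partialDeriv i ψ x ∂torusMeasure := by
  have h := integral_partialDeriv (hφ.mul hψ) i
  simp_rw [hφ.partialDeriv_mul hψ] at h
  have h1 : Integrable (fun x => partialDeriv i φ x * ψ x) torusMeasure :=
    ((hφ.partialDeriv i).continuous.mul hψ.continuous).integrable_torus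
  have h2 : Integrable (fun x => φ x * partialDeriv i ψ x) torusMeasure :=
    (hφ.continuous.mul (hψ.partialDeriv i).continuous).integrable_torus
  rw [integral_add h1 h2] at h
  linarith

/-! ### Fourier coefficients and Parseval's identity -/

/-- The cosine (`b = false`) and the sine (`b = true`) with frequency `ξ`. -/
def wave (ξ : Fin 2 → ℤ) (b : Bool) (x : Torus) : ℝ :=
  bif b then (mFourier ξ x).im else (mFourier ξ x).re

/-- The angular frequency in the `i`-th direction. -/
def freq (ξ : Fin 2 → ℤ) (i : Fin 2) : ℝ := 2 * Real.pi * ξ i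

/-- The sign in the derivative of the cosine and the sine. -/
def waveSign (b : Bool) : ℝ := bif b then 1 else -1

lemma waveSign_sq (b : Bool) : waveSign b ^ 2 = 1 := by cases b <;> simp [waveSign]

lemma waveSign_mul_not (b : Bool) : waveSign b * waveSign (!b) = -1 := by
  cases b <;> simp [waveSign]

lemma mFourier_toTorus (ξ : Fin 2 → ℤ) (y : Fin 2 → ℝ) :
    mFourier ξ (toTorus y) = Complex.exp (Complex.I * ((∑ i, freq ξ i * y i : ℝ) : ℂ)) := by
  simp only [mFourier, toTorus, ContinuousMap.coe_mk, fourier_coe_apply, ← Complex.exp_sum]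
  congr 1
  simp [freq, Fin.sum_univ_two]
  ring

lemma wave_toTorus (ξ : Fin 2 → ℤ) (b : Bool) (y : Fin 2 → ℝ) :
    wave ξ b (toTorus y) =
      bif b then Real.sin (∑ i, freq ξ i * y i) else Real.cos (∑ i, freq ξ i * y i) := by
  rw [wave, mFourier_toTorus, mul_comm Complex.I]
  cases b
  · simp only [cond_false, Complex.exp_ofReal_mul_I_re]
  · simp only [cond_true, Complex.exp_ofReal_mul_I_im]

lemma isSmooth_wave (ξ : Fin 2 → ℤ) (b : Bool) : IsSmooth (wave ξ b) := by
  rw [isSmooth_iff]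
  have : wave ξ b ∘ toTorus = fun y => bif b then Real.sin (∑ i, freq ξ i * y i) else
      Real.cos (∑ i, freq ξ i * y i) := funext fun y => wave_toTorus ξ b y
  rw [this]
  cases b
  · simp only [cond_false]; fun_prop
  · simp only [cond_true]; fun_prop

lemma partialDeriv_wave (i : Fin 2) (ξ : Fin 2 → ℤ) (b : Bool) (x : Torus) :
    partialDeriv i (wave ξ b) x = waveSign b * freq ξ i * wave ξ (!b) x := by
  obtain ⟨y, rfl⟩ := isOpenQuotientMap_toTorus.surjective x
  have key : ∀ h : ℝ, wave ξ b (toTorus y + Pi.single i (h : UnitAddCircle)) =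
      bif b then Real.sin (∑ j, freq ξ j * y j + freq ξ i * h) else
        Real.cos (∑ j, freq ξ j * y j + freq ξ i * h) := by
    intro h
    rw [← toTorus_single, ← toTorus_add, wave_toTorus]
    have : ∑ j, freq ξ j * (y + Pi.single i h : Fin 2 → ℝ) j = ∑ j, freq ξ j * y j + freq ξ i * h := by
      simp [mul_add, Finset.sum_add_distrib, Pi.single_apply]
    rw [this]
  have hd : HasDerivAt (fun h : ℝ => ∑ j, freq ξ j * y j + freq ξ i * h) (freq ξ i) 0 := by
    simpa using ((hasDerivAt_id (0 : ℝ)).const_mul (freq ξ i)).const_add (∑ j, freq ξ j * y j)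
  rw [partialDeriv, funext key, wave_toTorus]
  cases b
  · simp only [cond_false, Bool.not_false, cond_true, waveSign]
    rw [hd.cos.deriv]; simp; ring
  · simp only [cond_false, Bool.not_true, cond_true, waveSign]
    rw [hd.sin.deriv]; simp; ring

section Fields

lemma LTwo.integrable {F : Type} [NormedAddCommGroup F] (v : LTwo F) :
    Integrable v torusMeasure :=
  (Lp.memLp v).integrable (by norm_num)

variable {F : Type} [NormedAddCommGroup F] [InnerProductSpace ℝ F]

/-- The (vector-valued) Fourier coefficient of `v` with respect to a cosine or a sine. -/
def moment (ξ : Fin 2 → ℤ) (b : Bool) (v : LTwo F) : F := ∫ x, wave ξ b x • v x ∂torusMeasure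

/-- The energy of `v` at the frequency `ξ`. -/
def energy (ξ : Fin 2 → ℤ) (v : LTwo F) : ℝ := ∑ b : Bool, ‖moment ξ b v‖ ^ 2

lemma energy_nonneg (ξ : Fin 2 → ℤ) (v : LTwo F) : 0 ≤ energy ξ v :=
  Finset.sum_nonneg fun _ _ => sq_nonneg _

/-- Waves are admissible test functions, and differentiation exchanges cosine and sine up to the
factor `± freq ξ i`. -/
lemma HasWeakPartial.moment_eq {i : Fin 2} {v g : LTwo F} (h : HasWeakPartial i v g)
    (ξ : Fin 2 → ℤ) (b : Bool) :
    moment ξ b g = -((waveSign b * freq ξ i) • moment ξ (!b) v) := by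
  have := h _ (isSmooth_wave ξ b)
  simp_rw [partialDeriv_wave, mul_smul, integral_smul] at this
  rw [← mul_smul] at this
  rw [moment, moment, this, neg_neg]

lemma HasWeakPartial.energy_eq {i : Fin 2} {v g : LTwo F} (h : HasWeakPartial i v g)
    (ξ : Fin 2 → ℤ) : energy ξ g = freq ξ i ^ 2 * energy ξ v := by
  simp only [energy, Fintype.sum_bool, h.moment_eq, norm_neg, norm_smul, mul_pow, norm_mul,
    Real.norm_eq_abs, sq_abs, waveSign_sq, Bool.not_true, Bool.not_false]
  ring

lemma continuous_wave_smul (ξ : Fin 2 → ℤ) (b : Bool) (c : F) :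
    Continuous fun x => wave ξ b x • c := (isSmooth_wave ξ b).continuous.smul continuous_const

lemma integrable_smul_LTwo {φ : Torus → ℝ} (hφ : Continuous φ) (v : LTwo F) :
    Integrable (fun x => φ x • v x) torusMeasure := by
  obtain ⟨C, hC⟩ := isCompact_univ.exists_bound_of_continuousOn hφ.continuousOn
  exact (LTwo.integrable v).bdd_smul C hφ.aestronglyMeasurable
    (Filter.Eventually.of_forall fun x => hC x (Set.mem_univ _))

variable [SecondCountableTopology F]

/-- The field `x ↦ c cos (2πξ·x)` or `x ↦ c sin (2πξ·x)`. -/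
def waveField (ξ : Fin 2 → ℤ) (b : Bool) (c : F) : LTwo F :=
  ((continuous_wave_smul ξ b c).memLp_torus 2).toLp

lemma coeFn_waveField (ξ : Fin 2 → ℤ) (b : Bool) (c : F) :
    waveField ξ b c =ᵐ[torusMeasure] fun x => wave ξ b x • c := MemLp.coeFn_toLp _

variable [CompleteSpace F]

lemma inner_waveField (ξ : Fin 2 → ℤ) (b : Bool) (c : F) (v : LTwo F) :
    inner ℝ v (waveField ξ b c) = inner ℝ (moment ξ b v) c := by
  rw [L2.inner_def, moment, real_inner_comm,
    ← integral_inner (integrable_smul_LTwo (isSmooth_wave ξ b).continuous v)]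
  refine integral_congr_ae ?_
  filter_upwards [coeFn_waveField ξ b c] with x hx
  rw [hx, inner_smul_right, inner_smul_right, real_inner_comm]

lemma hasWeakPartial_waveField (i : Fin 2) (ξ : Fin 2 → ℤ) (b : Bool) (c : F) :
    HasWeakPartial i (waveField ξ b c) ((waveSign b * freq ξ i) • waveField ξ (!b) c) := by
  intro φ hφ
  have h1 : ∫ x, partialDeriv i φ x • waveField ξ b c x ∂torusMeasure =
      ∫ x, (partialDeriv i φ x * wave ξ b x) • c ∂torusMeasure := by
    refine integral_congr_ae ?_
    filter_upwards [coeFn_waveField ξ b c] with x hx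
    rw [hx, mul_smul]
  have h2 : ∫ x, φ x • ((waveSign b * freq ξ i) • waveField ξ (!b) c : LTwo F) x ∂torusMeasure =
      ∫ x, (φ x * partialDeriv i (wave ξ b) x) • c ∂torusMeasure := by
    refine integral_congr_ae ?_
    filter_upwards [coeFn_waveField ξ (!b) c,
      Lp.coeFn_smul (waveSign b * freq ξ i) (waveField ξ (!b) c)] with x hx hx2
    rw [hx2, Pi.smul_apply, hx, partialDeriv_wave, smul_smul, smul_smul, mul_assoc]
  rw [h1, h2, integral_smul_const, integral_smul_const,
    integral_partialDeriv_mul hφ (isSmooth_wave ξ b), neg_smul]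

lemma moment_add (ξ : Fin 2 → ℤ) (b : Bool) (v w : LTwo F) :
    moment ξ b (v + w) = moment ξ b v + moment ξ b w :=
  ext_inner_right ℝ fun c => by
    rw [inner_add_left, ← inner_waveField, ← inner_waveField, ← inner_waveField, inner_add_left]

lemma moment_smul (ξ : Fin 2 → ℤ) (b : Bool) (a : ℝ) (v : LTwo F) :
    moment ξ b (a • v) = a • moment ξ b v :=
  ext_inner_right ℝ fun c => by
    rw [real_inner_smul_left, ← inner_waveField, ← inner_waveField, real_inner_smul_left]

end Fields

section Parseval

/-- The complexification of a real function. -/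
def complexify (v : LTwo ℝ) : Lp ℂ 2 torusMeasure := Complex.ofRealCLM.compLp v

lemma coeFn_complexify (v : LTwo ℝ) : complexify v =ᵐ[torusMeasure] fun x => (v x : ℂ) :=
  Complex.ofRealCLM.coeFn_compLp v

lemma mFourierCoeff_complexify (v : LTwo ℝ) (ξ : Fin 2 → ℤ) :
    mFourierCoeff (complexify v) ξ = moment ξ false v - Complex.I * moment ξ true v := by
  have h : mFourierCoeff (complexify v) ξ =
      ∫ x, ((((wave ξ false x • v x : ℝ) : ℂ)) - Complex.I * ((wave ξ true x • v x : ℝ) : ℂ))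
        ∂torusMeasure := by
    refine integral_congr_ae ?_
    filter_upwards [coeFn_complexify v] with x hx
    rw [hx, mFourier_neg, smul_eq_mul]
    apply Complex.ext <;> simp [wave]
  rw [h, integral_sub, integral_const_mul, integral_complex_ofReal, integral_complex_ofReal]
  · rfl
  · exact (integrable_smul_LTwo (isSmooth_wave ξ false).continuous v).ofReal
  · exact (integrable_smul_LTwo (isSmooth_wave ξ true).continuous v).ofReal.const_mul _

lemma norm_sq_mFourierCoeff_complexify (v : LTwo ℝ) (ξ : Fin 2 → ℤ) :
    ‖mFourierCoeff (complexify v) ξ‖ ^ 2 = energy ξ v := by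
  rw [mFourierCoeff_complexify, energy, Fintype.sum_bool, ← Complex.normSq_eq_norm_sq,
    Complex.normSq_apply]
  simp
  ring

lemma norm_sq_LTwo {F : Type} [NormedAddCommGroup F] [InnerProductSpace ℝ F] (v : LTwo F) :
    ‖v‖ ^ 2 = ∫ x, ‖v x‖ ^ 2 ∂torusMeasure := by
  rw [← real_inner_self_eq_norm_sq, L2.inner_def]
  simp_rw [real_inner_self_eq_norm_sq]

/-- The complex Fourier coefficient has real part the cosine moment and imaginary part minus the
sine moment. Since `ξ` and `-ξ` are both summed, the real waves need no factor `√2`. -/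
lemma hasSum_energy_real (v : LTwo ℝ) : HasSum (fun ξ => energy ξ v) (‖v‖ ^ 2) := by
  have h := hasSum_sq_mFourierCoeff (d := Fin 2) (complexify v)
  simp_rw [norm_sq_mFourierCoeff_complexify] at h
  convert h using 1
  rw [norm_sq_LTwo]
  refine integral_congr_ae ?_
  filter_upwards [coeFn_complexify v] with x hx
  rw [hx, Complex.norm_real]

lemma coeFn_component (j : Fin 2) (v : LTwo Vec) :
    component j v =ᵐ[torusMeasure] fun x => v x j :=
  (EuclideanSpace.proj j : Vec →L[ℝ] ℝ).coeFn_compLp v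

lemma moment_component (j : Fin 2) (v : LTwo Vec) (ξ : Fin 2 → ℤ) (b : Bool) :
    moment ξ b (component j v) = moment ξ b v j := by
  have h := (EuclideanSpace.proj j : Vec →L[ℝ] ℝ).integral_comp_comm
    (integrable_smul_LTwo (isSmooth_wave ξ b).continuous v)
  rw [moment, moment]
  refine Eq.trans (integral_congr_ae ?_) h
  filter_upwards [coeFn_component j v] with x hx
  simp [hx]

lemma energy_eq_sum_component (ξ : Fin 2 → ℤ) (v : LTwo Vec) :
    energy ξ v = ∑ j : Fin 2, energy ξ (component j v) := by
  simp only [energy, moment_component, EuclideanSpace.norm_sq_eq]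
  rw [Finset.sum_comm]

lemma norm_sq_eq_sum_component (v : LTwo Vec) : ‖v‖ ^ 2 = ∑ j : Fin 2, ‖component j v‖ ^ 2 := by
  have h : ∀ j, Integrable (fun x => ‖component j v x‖ ^ 2) torusMeasure :=
    fun j => (Lp.memLp (component j v)).norm.integrable_sq
  simp_rw [norm_sq_LTwo]
  rw [← integral_finsetSum _ fun j _ => h j]
  refine integral_congr_ae ?_
  filter_upwards [coeFn_component 0 v, coeFn_component 1 v] with x h0 h1
  simp [EuclideanSpace.norm_sq_eq, Fin.sum_univ_two, h0, h1]

lemma hasSum_energy (v : LTwo Vec) : HasSum (fun ξ => energy ξ v) (‖v‖ ^ 2) := by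
  simp_rw [energy_eq_sum_component, norm_sq_eq_sum_component]
  exact hasSum_sum fun j _ => hasSum_energy_real _

/-- Parseval's identity enters as a hypothesis so that scalar functions and velocity fields share
the argument. It yields uniqueness of weak derivatives, hence identifies the one selected by choice
in `weakPartial`. -/
lemma eq_of_moment_eq_of_hasSum {F : Type} [NormedAddCommGroup F] [InnerProductSpace ℝ F]
    [CompleteSpace F] [SecondCountableTopology F]
    (hF : ∀ v : LTwo F, HasSum (fun ξ => energy ξ v) (‖v‖ ^ 2)) {v w : LTwo F}
    (h : ∀ ξ b, moment ξ b v = moment ξ b w) : v = w := by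
  have h1 : ∀ ξ, energy ξ (v - w) = 0 := fun ξ => by
    have : v - w = v + (-1 : ℝ) • w := by simp [sub_eq_add_neg]
    simp only [energy, this, moment_add, moment_smul, h]
    simp
  have h2 := hF (v - w)
  simp_rw [h1] at h2
  have := h2.unique hasSum_zero
  rwa [sq_eq_zero_iff, norm_eq_zero, sub_eq_zero] at this

lemma HasWeakPartial.weakPartial_eq {i : Fin 2} {v g : LTwo Vec} (h : HasWeakPartial i v g) :
    weakPartial i v = g := by
  have hex : ∃ g, HasWeakPartial i v g := ⟨g, h⟩
  rw [weakPartial, dif_pos hex]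
  exact eq_of_moment_eq_of_hasSum hasSum_energy fun ξ b => by
    rw [hex.choose_spec.moment_eq, h.moment_eq]

lemma HasWeakPartial.weakPartial_eq_real {i : Fin 2} {v g : LTwo ℝ} (h : HasWeakPartial i v g) :
    weakPartial i v = g := by
  have hex : ∃ g, HasWeakPartial i v g := ⟨g, h⟩
  rw [weakPartial, dif_pos hex]
  exact eq_of_moment_eq_of_hasSum hasSum_energy_real fun ξ b => by
    rw [hex.choose_spec.moment_eq, h.moment_eq]

end Parseval

/-! ### Existence of weak derivatives -/

section WeakPartial

lemma HasWeakPartial.mFourierCoeff_complexify {i : Fin 2} {v g : LTwo ℝ}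
    (h : HasWeakPartial i v g) (ξ : Fin 2 → ℤ) :
    mFourierCoeff (complexify g) ξ = Complex.I * freq ξ i * mFourierCoeff (complexify v) ξ := by
  simp only [StochasticStokes.mFourierCoeff_complexify, h.moment_eq, waveSign]
  apply Complex.ext <;> simp

lemma IsSmooth.hasWeakPartial_toLp {φ : Torus → ℝ} (hφ : IsSmooth φ) (i : Fin 2) :
    HasWeakPartial i ((hφ.continuous.memLp_torus 2).toLp)
      (((hφ.partialDeriv i).continuous.memLp_torus 2).toLp) := by
  intro ψ hψ
  refine Eq.trans (integral_congr_ae ?_) ((integral_partialDeriv_mul hψ hφ i).trans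
    (congrArg Neg.neg (integral_congr_ae ?_)))
  · filter_upwards [(hφ.continuous.memLp_torus 2).coeFn_toLp] with x hx
    rw [hx, smul_eq_mul]
  · filter_upwards [((hφ.partialDeriv i).continuous.memLp_torus 2).coeFn_toLp] with x hx
    rw [hx, smul_eq_mul]

lemma exists_mFourierCoeff_eq {a : (Fin 2 → ℤ) → ℂ} (ha : Summable fun ξ => ‖a ξ‖ ^ 2) :
    ∃ g : Lp ℂ 2 torusMeasure, ∀ ξ, mFourierCoeff g ξ = a ξ := by
  have hm : Memℓp a 2 := memℓp_gen (by simpa using ha)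
  refine ⟨(mFourierBasis (d := Fin 2)).repr.symm ⟨a, hm⟩, fun ξ => ?_⟩
  exact ((mFourierBasis_repr (d := Fin 2) _ ξ).symm.trans (by
    rw [LinearIsometryEquiv.apply_symm_apply]))

lemma integral_mul_re {φ : LTwo ℝ} {g : Lp ℂ 2 torusMeasure} :
    ∫ x, φ x * (g x).re ∂torusMeasure =
      (∫ x, (starRingEnd ℂ) (complexify φ x) * g x ∂torusMeasure).re := by
  have hint : Integrable (fun x => (starRingEnd ℂ) (complexify φ x) * g x) torusMeasure := by
    have := L2.integrable_inner (𝕜 := ℂ) (complexify φ) g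
    simpa [RCLike.inner_apply, mul_comm] using! this
  have h := integral_re hint
  simp only [RCLike.re_to_complex] at h
  rw [← h]
  refine integral_congr_ae ?_
  filter_upwards [coeFn_complexify φ] with x hx
  simp [hx]

/-- Riesz–Fischer supplies a complex function with coefficients `i freq ξ` times those of `v`;
Parseval against a smooth test function is then the integration-by-parts identity. As the test
functions are real, taking the real part suffices, and the candidate need not be shown to be real.
-/
lemma exists_hasWeakPartial_real (i : Fin 2) {v : LTwo ℝ}
    (h : Summable fun ξ => freq ξ i ^ 2 * energy ξ v) : ∃ g, HasWeakPartial i v g := by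
  obtain ⟨G, hG⟩ := exists_mFourierCoeff_eq
    (a := fun ξ => Complex.I * freq ξ i * mFourierCoeff (complexify v) ξ) (by
      simpa [mul_pow, norm_sq_mFourierCoeff_complexify] using h)
  have hg := Complex.reCLM.coeFn_compLp G
  refine ⟨Complex.reCLM.compLp G, fun φ hφ => ?_⟩
  have hc := hφ.hasWeakPartial_toLp i
  set φL : LTwo ℝ := (hφ.continuous.memLp_torus 2).toLp
  set dL : LTwo ℝ := ((hφ.partialDeriv i).continuous.memLp_torus 2).toLp
  have e1 : ∫ x, partialDeriv i φ x • v x ∂torusMeasure =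
      (∫ x, (starRingEnd ℂ) (complexify dL x) * complexify v x ∂torusMeasure).re := by
    rw [← integral_mul_re]
    refine integral_congr_ae ?_
    filter_upwards [((hφ.partialDeriv i).continuous.memLp_torus 2).coeFn_toLp,
      coeFn_complexify v] with x hx hx'
    rw [hx, hx']; simp
  have e2 : ∫ x, φ x • (Complex.reCLM.compLp G : LTwo ℝ) x ∂torusMeasure =
      (∫ x, (starRingEnd ℂ) (complexify φL x) * G x ∂torusMeasure).re := by
    rw [← integral_mul_re]
    refine integral_congr_ae ?_
    filter_upwards [(hφ.continuous.memLp_torus 2).coeFn_toLp, hg] with x hx hx'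
    rw [hx, hx']; simp
  have s1 := hasSum_prod_mFourierCoeff (d := Fin 2) (complexify dL) (complexify v)
  have s2 := (hasSum_prod_mFourierCoeff (d := Fin 2) (complexify φL) G).neg
  have : (fun ξ => (starRingEnd ℂ) (mFourierCoeff (complexify dL) ξ) *
      mFourierCoeff (complexify v) ξ) = fun ξ => -((starRingEnd ℂ)
        (mFourierCoeff (complexify φL) ξ) * mFourierCoeff G ξ) := by
    funext ξ
    rw [hG, hc.mFourierCoeff_complexify]
    simp
    ring
  rw [this] at s1
  rw [e1, e2, ← Complex.neg_re]
  exact congrArg Complex.re (s1.unique s2)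

lemma integral_smul_apply {φ : Torus → ℝ} (hφ : Continuous φ) (v : LTwo Vec) (j : Fin 2) :
    (∫ x, φ x • v x ∂torusMeasure) j = ∫ x, φ x • component j v x ∂torusMeasure := by
  have h := (EuclideanSpace.proj j : Vec →L[ℝ] ℝ).integral_comp_comm (integrable_smul_LTwo hφ v)
  refine Eq.trans h.symm (integral_congr_ae ?_)
  filter_upwards [coeFn_component j v] with x hx
  simp [hx]

lemma exists_component_eq (g : Fin 2 → LTwo ℝ) : ∃ w : LTwo Vec, ∀ j, component j w = g j := by
  have hm : MemLp (fun x => (WithLp.toLp 2 fun j => g j x : Vec)) 2 torusMeasure := by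
    have h : ∀ j, MemLp (fun x => g j x • (EuclideanSpace.single j (1 : ℝ) : Vec)) 2 torusMeasure :=
      fun j => (((LinearMap.toSpanSingleton ℝ Vec
        (EuclideanSpace.single j (1 : ℝ))).toContinuousLinearMap).comp_memLp (g j))
    refine ((h 0).add (h 1)).ae_eq (Filter.Eventually.of_forall fun x => ?_)
    ext j
    fin_cases j <;> simp
  refine ⟨hm.toLp, fun j => Lp.ext ?_⟩
  filter_upwards [coeFn_component j hm.toLp, hm.coeFn_toLp] with x h1 h2
  rw [h1, h2]

lemma exists_hasWeakPartial (i : Fin 2) {v : LTwo Vec}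
    (h : Summable fun ξ => freq ξ i ^ 2 * energy ξ v) : ∃ g, HasWeakPartial i v g := by
  have hj : ∀ j, ∃ g, HasWeakPartial i (component j v) g := fun j =>
    exists_hasWeakPartial_real i <| h.of_nonneg_of_le
      (fun ξ => mul_nonneg (sq_nonneg _) (energy_nonneg _ _)) fun ξ => by
        gcongr
        rw [energy_eq_sum_component]
        exact Finset.single_le_sum (f := fun j => energy ξ (component j v))
          (fun j _ => energy_nonneg _ _) (Finset.mem_univ j)
  choose g hg using hj
  obtain ⟨w, hw⟩ := exists_component_eq g
  refine ⟨w, fun φ hφ => ?_⟩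
  ext j
  rw [PiLp.neg_apply, integral_smul_apply (hφ.partialDeriv i).continuous,
    integral_smul_apply hφ.continuous, hw]
  exact hg j φ hφ

end WeakPartial

/-! ### Sobolev norms as weighted sums of Fourier energies -/

section Sobolev

/-- The eigenvalue of `-Δ` for the frequency `ξ`. -/
def eigen (ξ : Fin 2 → ℤ) : ℝ := ∑ i, freq ξ i ^ 2

lemma eigen_nonneg (ξ : Fin 2 → ℤ) : 0 ≤ eigen ξ := Finset.sum_nonneg fun _ _ => sq_nonneg _

lemma enorm_sq_eq_ofReal {E : Type*} [NormedAddCommGroup E] (x : E) :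
    ‖x‖ₑ ^ 2 = ENNReal.ofReal (‖x‖ ^ 2) := by
  rw [ENNReal.ofReal_pow (norm_nonneg x), ofReal_norm]

lemma enorm_sq_eq_tsum (v : LTwo Vec) : ‖v‖ₑ ^ 2 = ∑' ξ, ENNReal.ofReal (energy ξ v) := by
  rw [enorm_sq_eq_ofReal, ← (hasSum_energy v).tsum_eq,
    ENNReal.ofReal_tsum_of_nonneg (fun ξ => energy_nonneg ξ v) (hasSum_energy v).summable]

lemma exists_hasWeakPartial_of_tsum_ne_top (i : Fin 2) {v : LTwo Vec}
    (h : ∑' ξ, ENNReal.ofReal (freq ξ i ^ 2 * energy ξ v) ≠ ∞) : ∃ g, HasWeakPartial i v g := by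
  refine exists_hasWeakPartial i ((ENNReal.summable_toReal h).congr fun ξ => ?_)
  rw [ENNReal.toReal_ofReal (mul_nonneg (sq_nonneg _) (energy_nonneg _ _))]

lemma tsum_eigen_mul_energy (v : LTwo Vec) (k : ℕ) :
    ∑' ξ, ENNReal.ofReal (eigen ξ ^ (k + 1) * energy ξ v) =
      ∑ i : Fin 2, ∑' ξ, ENNReal.ofReal (eigen ξ ^ k * (freq ξ i ^ 2 * energy ξ v)) := by
  rw [← Summable.tsum_finsetSum fun i _ => ENNReal.summable]
  congr 1
  funext ξ
  rw [← ENNReal.ofReal_sum_of_nonneg fun i _ => mul_nonneg (pow_nonneg (eigen_nonneg ξ) k)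
    (mul_nonneg (sq_nonneg _) (energy_nonneg ξ v)), ← Finset.mul_sum, ← Finset.sum_mul, pow_succ,
    mul_assoc, ← eigen]

/-- This inequality serves for errors and the reverse type, `tsum_le_sobolevSq`, for data. If the
weighted sum is infinite nothing is claimed; if it is finite, a weak derivative exists and bounds
the infimum. -/
lemma gradSq_le (v : LTwo Vec) : gradSq v ≤ ∑' ξ, ENNReal.ofReal (eigen ξ * energy ξ v) := by
  have := tsum_eigen_mul_energy v 0
  simp only [pow_zero, one_mul, zero_add, pow_one] at this
  rw [this, gradSq]
  refine Finset.sum_le_sum fun i _ => ?_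
  by_cases h : ∑' ξ, ENNReal.ofReal (freq ξ i ^ 2 * energy ξ v) = ∞
  · rw [h]; exact le_top
  · obtain ⟨g, hg⟩ := exists_hasWeakPartial_of_tsum_ne_top i h
    refine (iInf₂_le g hg).trans ?_
    rw [enorm_sq_eq_tsum]
    simp_rw [hg.energy_eq]
    exact le_rfl

/-- Every weak derivative `g` has energies `freq² * energy`, so the induction hypothesis for `g`
bounds each candidate of the infimum; an empty infimum is infinite. -/
lemma tsum_le_sobolevSq (k : ℕ) (v : LTwo Vec) :
    ∑' ξ, ENNReal.ofReal (eigen ξ ^ k * energy ξ v) ≤ sobolevSq k v := by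
  induction k generalizing v with
  | zero => simp [sobolevSq, enorm_sq_eq_tsum]
  | succ k ih =>
    rw [tsum_eigen_mul_energy, sobolevSq]
    refine le_add_left (Finset.sum_le_sum fun i _ => le_iInf₂ fun g hg => ?_)
    refine le_trans (le_of_eq ?_) (ih g)
    simp_rw [hg.energy_eq]

lemma enorm_sq_le_sobolevSq {F : Type} [NormedAddCommGroup F] [NormedSpace ℝ F] (k : ℕ)
    (v : LTwo F) : ‖v‖ₑ ^ 2 ≤ sobolevSq k v := by
  cases k with
  | zero => exact le_rfl
  | succ k => exact le_self_add

lemma memSobolev_one_iff {F : Type} [NormedAddCommGroup F] [NormedSpace ℝ F] {v : LTwo F} :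
    MemSobolev 1 v ↔ ∀ i, ∃ g, HasWeakPartial i v g := by
  constructor
  · intro h i
    by_contra hne
    push Not at hne
    refine absurd h (not_lt_of_ge ?_)
    rw [sobolevSq]
    refine le_add_left (le_trans ?_ (Finset.single_le_sum (fun _ _ => zero_le)
      (Finset.mem_univ i)))
    simp [hne]
  · intro h
    rw [MemSobolev, sobolevSq]
    refine ENNReal.add_lt_top.2 ⟨by finiteness, ENNReal.sum_lt_top.2 fun i _ => ?_⟩
    obtain ⟨g, hg⟩ := h i
    exact (iInf₂_le g hg).trans_lt (by rw [sobolevSq]; finiteness)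

lemma MemSobolev.hasWeakPartial {F : Type} [NormedAddCommGroup F] [NormedSpace ℝ F] {v : LTwo F}
    (h : MemSobolev 1 v) (i : Fin 2) : HasWeakPartial i v (weakPartial i v) := by
  have hex := memSobolev_one_iff.1 h i
  rw [weakPartial, dif_pos hex]
  exact hex.choose_spec

lemma memSobolev_one_of_tsum_ne_top {v : LTwo Vec}
    (h : ∑' ξ, ENNReal.ofReal (eigen ξ * energy ξ v) ≠ ∞) : MemSobolev 1 v := by
  have := tsum_eigen_mul_energy v 0
  simp only [pow_zero, one_mul, zero_add, pow_one] at this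
  rw [this] at h
  exact memSobolev_one_iff.2 fun i => exists_hasWeakPartial_of_tsum_ne_top i
    (ENNReal.sum_ne_top.1 h i (Finset.mem_univ i))

lemma memSobolev_one_waveField {F : Type} [NormedAddCommGroup F] [InnerProductSpace ℝ F]
    [CompleteSpace F] [SecondCountableTopology F] (ξ : Fin 2 → ℤ) (b : Bool) (c : F) :
    MemSobolev 1 (waveField ξ b c) :=
  memSobolev_one_iff.2 fun i => ⟨_, hasWeakPartial_waveField i ξ b c⟩

lemma MemSobolev.add {v w : LTwo Vec} (hv : MemSobolev 1 v) (hw : MemSobolev 1 w) :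
    MemSobolev 1 (v + w) := by
  refine memSobolev_one_iff.2 fun i => ⟨weakPartial i v + weakPartial i w, fun φ hφ => ?_⟩
  have h1 : ∀ {ψ : Torus → ℝ} (_ : Continuous ψ) (a b : LTwo Vec),
      ∫ x, ψ x • (a + b : LTwo Vec) x ∂torusMeasure =
        ∫ x, ψ x • a x ∂torusMeasure + ∫ x, ψ x • b x ∂torusMeasure := by
    intro ψ hψ a b
    rw [← integral_add (integrable_smul_LTwo hψ a) (integrable_smul_LTwo hψ b)]
    refine integral_congr_ae ?_
    filter_upwards [Lp.coeFn_add a b] with x hx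
    rw [hx, Pi.add_apply, smul_add]
  rw [h1 (hφ.partialDeriv i).continuous, h1 hφ.continuous, hv.hasWeakPartial i φ hφ,
    hw.hasWeakPartial i φ hφ, neg_add]

lemma MemSobolev.smul {v : LTwo Vec} (hv : MemSobolev 1 v) (a : ℝ) : MemSobolev 1 (a • v) := by
  refine memSobolev_one_iff.2 fun i => ⟨a • weakPartial i v, fun φ hφ => ?_⟩
  have h1 : ∀ {ψ : Torus → ℝ} (b : LTwo Vec),
      ∫ x, ψ x • (a • b : LTwo Vec) x ∂torusMeasure = a • ∫ x, ψ x • b x ∂torusMeasure := by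
    intro ψ b
    rw [← integral_smul]
    refine integral_congr_ae ?_
    filter_upwards [Lp.coeFn_smul a b] with x hx
    rw [hx, Pi.smul_apply, smul_comm]
  rw [h1, h1, hv.hasWeakPartial i φ hφ, smul_neg]

end Sobolev

/-! ### Solenoidal eigenfields -/

/-- The wave vector `2πξ`. -/
def freqVec (ξ : Fin 2 → ℤ) : Vec := WithLp.toLp 2 (freq ξ)

/-- The projection of the `j`-th unit vector onto the orthogonal complement of `ξ`. -/
def modeDir (ξ : Fin 2 → ℤ) (j : Fin 2) : Vec :=
  EuclideanSpace.single j 1 - (freq ξ j / eigen ξ) • freqVec ξ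

/-- The solenoidal eigenfields of the Stokes operator. -/
def mode (ξ : Fin 2 → ℤ) (j : Fin 2) (b : Bool) : LTwo Vec := waveField ξ b (modeDir ξ j)

/-- All Fourier coefficients of `v` are orthogonal to the wave vector. -/
def FreqOrthogonal (v : LTwo Vec) : Prop := ∀ ξ b, ∑ i, freq ξ i * moment ξ b v i = 0

lemma FreqOrthogonal.sub {v w : LTwo Vec} (hv : FreqOrthogonal v) (hw : FreqOrthogonal w) :
    FreqOrthogonal (v - w) := fun ξ b => by
  have : v - w = v + (-1 : ℝ) • w := by simp [sub_eq_add_neg]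
  rw [this, moment_add, moment_smul]
  have h1 := hv ξ b
  have h2 := hw ξ b
  simp only [Fin.sum_univ_two, PiLp.add_apply, PiLp.smul_apply, smul_eq_mul] at *
  linarith

lemma FreqOrthogonal.add {v w : LTwo Vec} (hv : FreqOrthogonal v) (hw : FreqOrthogonal w) :
    FreqOrthogonal (v + w) := fun ξ b => by
  rw [moment_add]
  have h1 := hv ξ b
  have h2 := hw ξ b
  simp only [Fin.sum_univ_two, PiLp.add_apply] at *
  linarith

lemma FreqOrthogonal.smul {v : LTwo Vec} (hv : FreqOrthogonal v) (a : ℝ) :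
    FreqOrthogonal (a • v) := fun ξ b => by
  rw [moment_smul]
  have h1 := hv ξ b
  simp only [Fin.sum_univ_two, PiLp.smul_apply, smul_eq_mul] at *
  linear_combination a * h1

lemma inner_freqVec (ξ : Fin 2 → ℤ) (m : Vec) : inner ℝ m (freqVec ξ) = ∑ i, freq ξ i * m i := by
  simp [PiLp.inner_apply, freqVec]

lemma inner_mode_of_freqOrthogonal {v : LTwo Vec} (hv : FreqOrthogonal v) (ξ : Fin 2 → ℤ)
    (j : Fin 2) (b : Bool) : inner ℝ v (mode ξ j b) = moment ξ b v j := by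
  rw [mode, inner_waveField, modeDir, inner_sub_right, inner_smul_right, inner_freqVec, hv ξ b]
  simp [EuclideanSpace.inner_single_right]

/-- The projected directions for `j = 0, 1` are linearly dependent when `ξ ≠ 0`. Nevertheless, for a
coefficient already orthogonal to `ξ`, pairing with the projection of a unit vector gives its `j`-th
coordinate, so the squares add up to its norm. -/
lemma energy_eq_sum_mode {v : LTwo Vec} (hv : FreqOrthogonal v) (ξ : Fin 2 → ℤ) :
    energy ξ v = ∑ jb : Fin 2 × Bool, inner ℝ v (mode ξ jb.1 jb.2) ^ 2 := by
  rw [Fintype.sum_prod_type, Finset.sum_comm]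
  simp [energy, inner_mode_of_freqOrthogonal hv, EuclideanSpace.norm_sq_eq]

lemma moment_not_weakPartial {v : LTwo Vec} (h : MemSobolev 1 v) (i : Fin 2) (ξ : Fin 2 → ℤ)
    (b : Bool) : waveSign b • moment ξ (!b) (weakPartial i v) = freq ξ i • moment ξ b v := by
  rw [(h.hasWeakPartial i).moment_eq, Bool.not_not, smul_neg, smul_smul, ← neg_smul, ← mul_assoc,
    waveSign_mul_not]
  simp

lemma inner_divergence_waveField {v : LTwo Vec} (h : MemSobolev 1 v) (ξ : Fin 2 → ℤ) (b : Bool) :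
    waveSign b * inner ℝ (divergence v) (waveField ξ (!b) (1 : ℝ)) =
      ∑ i, freq ξ i * moment ξ b v i := by
  rw [divergence, sum_inner, Finset.mul_sum]
  refine Finset.sum_congr rfl fun i _ => ?_
  rw [inner_waveField, moment_component]
  have := congrArg (fun z : Vec => z i) (moment_not_weakPartial h i ξ b)
  simpa using! this

lemma component_smul_waveField (i : Fin 2) (a : ℝ) (ξ : Fin 2 → ℤ) (b : Bool) (c : Vec) :
    component i (a • waveField ξ b c) =ᵐ[torusMeasure] fun x => a * (wave ξ b x * c i) := by
  filter_upwards [coeFn_component i (a • waveField ξ b c), Lp.coeFn_smul a (waveField ξ b c),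
    coeFn_waveField ξ b c] with x h1 h2 h3
  rw [h1, h2, Pi.smul_apply, h3]
  simp

lemma weakPartial_mode (i : Fin 2) (ξ : Fin 2 → ℤ) (j : Fin 2) (b : Bool) :
    weakPartial i (mode ξ j b) = (waveSign b * freq ξ i) • waveField ξ (!b) (modeDir ξ j) :=
  (hasWeakPartial_waveField i ξ b _).weakPartial_eq

lemma sum_freq_mul_modeDir (ξ : Fin 2 → ℤ) (j : Fin 2) : ∑ i, freq ξ i * modeDir ξ j i = 0 := by
  -- At frequency zero the division by `eigen ξ` gives zero and leaves constant fields, which are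
  -- solenoidal trivially.
  by_cases h : eigen ξ = 0
  · have : ∀ i, freq ξ i = 0 := fun i => by
      have := (Finset.sum_eq_zero_iff_of_nonneg fun i _ => sq_nonneg (freq ξ i)).1 h i
        (Finset.mem_univ i)
      simpa using this
    simp [this]
  · have h1 : ∑ i, freq ξ i * modeDir ξ j i =
        freq ξ j - freq ξ j / eigen ξ * ∑ i, freq ξ i ^ 2 := by
      rw [Finset.mul_sum]
      simp only [modeDir, freqVec, PiLp.sub_apply, PiLp.smul_apply, smul_eq_mul, mul_sub,
        Finset.sum_sub_distrib]
      congr 1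
      · simp
      · exact Finset.sum_congr rfl fun i _ => by ring
    rw [h1, ← eigen, div_mul_cancel₀ _ h, sub_self]

/-- This makes the eigenfields admissible in the weak equation and annihilates the pressure term of
the scheme. -/
lemma memV_mode (ξ : Fin 2 → ℤ) (j : Fin 2) (b : Bool) : MemV (mode ξ j b) := by
  refine ⟨memSobolev_one_waveField ξ b _, ?_⟩
  refine Lp.ext ?_
  have h := fun i => component_smul_waveField i (waveSign b * freq ξ i) ξ (!b) (modeDir ξ j)
  rw [divergence, Fin.sum_univ_two, weakPartial_mode, weakPartial_mode]
  refine (Lp.coeFn_add _ _).trans ?_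
  filter_upwards [h 0, h 1, Lp.coeFn_zero ℝ 2 torusMeasure] with x h0 h1 h2
  rw [h2, Pi.add_apply, h0, h1]
  have := sum_freq_mul_modeDir ξ j
  rw [Fin.sum_univ_two] at this
  simp only [Pi.zero_apply]
  linear_combination (waveSign b * wave ξ (!b) x) * this

/-- Membership in `H¹` is essential: outside it `weakPartial` may take its default value zero. This
is why the noise and the iterates must be shown to lie in `H¹`. -/
lemma gradInner_mode {v : LTwo Vec} (h : MemSobolev 1 v) (ξ : Fin 2 → ℤ) (j : Fin 2) (b : Bool) :
    gradInner v (mode ξ j b) = eigen ξ * inner ℝ v (mode ξ j b) := by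
  rw [gradInner, eigen, Finset.sum_mul]
  refine Finset.sum_congr rfl fun i _ => ?_
  have := congrArg (fun z : Vec => inner ℝ z (modeDir ξ j)) (moment_not_weakPartial h i ξ b)
  simp only [real_inner_smul_left] at this
  rw [weakPartial_mode, inner_smul_right, inner_waveField, mode, inner_waveField]
  linear_combination freq ξ i * this

/-- Test with the gradient of the wave of opposite parity, which has the parity of the moment in
question. -/
lemma IsSolenoidal.freqOrthogonal {v : LTwo Vec} (hv : IsSolenoidal v) : FreqOrthogonal v := by
  intro ξ b
  have h := hv (waveField ξ (!b) (1 : ℝ)) (memSobolev_one_waveField ξ _ _)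
  have h2 : ∀ i, inner ℝ (component i v) (weakPartial i (waveField ξ (!b) (1 : ℝ))) =
      waveSign (!b) * (freq ξ i * moment ξ b v i) := fun i => by
    rw [(hasWeakPartial_waveField i ξ (!b) (1 : ℝ)).weakPartial_eq_real, inner_smul_right,
      Bool.not_not, inner_waveField, moment_component]
    simp
    ring
  simp_rw [h2, ← Finset.mul_sum] at h
  refine (mul_eq_zero.1 h).resolve_left ?_
  cases b <;> simp [waveSign]

lemma isPressure_waveField {ξ : Fin 2 → ℤ} {i : Fin 2} (h : freq ξ i ≠ 0) (b : Bool) :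
    IsPressure (waveField ξ b (1 : ℝ)) := by
  have h0 := integral_partialDeriv (isSmooth_wave ξ (!b)) i
  simp_rw [partialDeriv_wave, integral_const_mul, Bool.not_not] at h0
  have h1 : ∫ x, wave ξ b x ∂torusMeasure = 0 :=
    (mul_eq_zero.1 h0).resolve_left (mul_ne_zero (by cases b <;> simp [waveSign]) h)
  rw [IsPressure, ← h1]
  refine integral_congr_ae ?_
  filter_upwards [coeFn_waveField ξ b (1 : ℝ)] with x hx
  rw [hx, smul_eq_mul, mul_one]

/-- Waves of nonzero frequency are derivatives, hence have mean zero and are admissible pressures;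
at frequency zero the condition is void. -/
lemma freqOrthogonal_of_incompressible {v : LTwo Vec} (hv : MemSobolev 1 v)
    (h : ∀ q : LTwo ℝ, IsPressure q → inner ℝ (divergence v) q = 0) : FreqOrthogonal v := by
  intro ξ b
  by_cases h0 : ∃ i, freq ξ i ≠ 0
  · obtain ⟨i, hi⟩ := h0
    rw [← inner_divergence_waveField hv, h _ (isPressure_waveField hi _), mul_zero]
  · push Not at h0
    simp [h0]

/-! ### The noise -/

section Orthogonal

lemma summable_of_pairwise_orthogonal {ι E : Type*} [NormedAddCommGroup E] [InnerProductSpace ℝ E]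
    [CompleteSpace E] {x : ι → E} (h : Pairwise fun i j => inner ℝ (x i) (x j) = 0)
    (hs : Summable fun i => ‖x i‖ ^ 2) : Summable x := by
  have hV : OrthogonalFamily ℝ (fun i => Submodule.span ℝ {x i})
      fun i => (Submodule.span ℝ {x i}).subtypeₗᵢ := by
    intro i j hij v w
    obtain ⟨a, ha⟩ := Submodule.mem_span_singleton.1 v.2
    obtain ⟨b, hb⟩ := Submodule.mem_span_singleton.1 w.2
    change inner ℝ (v : E) (w : E) = 0
    rw [← ha, ← hb, real_inner_smul_left, inner_smul_right, h hij, mul_zero, mul_zero]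
  exact (hV.summable_iff_norm_sq_summable
    fun i => ⟨x i, Submodule.mem_span_singleton_self (x i)⟩).2 hs

end Orthogonal

section Noise

variable {Ω : Type*} {mΩ : MeasurableSpace Ω} {P : Measure Ω} {𝓕 : Filtration ℝ≥0 mΩ}
variable {ι : Type*} {H : Type*} [NormedAddCommGroup H] [InnerProductSpace ℝ H]
variable {W : ι → ℝ≥0 → Ω → ℝ}

lemma IsCylindricalWiener.memLp (hW : IsCylindricalWiener 𝓕 P W) (k : ι) (t : ℝ≥0) :
    MemLp (W k t) 2 P :=
  ((hW.brownian k).hasLaw_eval t).hasGaussianLaw.memLp_two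

open Classical in
lemma IsCylindricalWiener.integral_mul [IsProbabilityMeasure P] (hW : IsCylindricalWiener 𝓕 P W)
    (k l : ι) (s t : ℝ≥0) :
    ∫ ω, W k s ω * W l t ω ∂P = if k = l then ((min s t : ℝ≥0) : ℝ) else 0 := by
  split_ifs with h
  · subst h
    have h1 := (hW.brownian k).covariance_eval s t
    rw [covariance_eq_sub (hW.memLp k s) (hW.memLp k t), (hW.brownian k).integral_eval] at h1
    simpa using h1
  · have h1 : IndepFun (W k s) (W l t) P :=
      (hW.indep.indepFun h).comp (measurable_pi_apply s) (measurable_pi_apply t)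
    have h2 := h1.integral_mul_eq_mul_integral (hW.memLp k s).1 (hW.memLp l t).1
    rw [(hW.brownian k).integral_eval, zero_mul] at h2
    exact h2

variable (e : HilbertBasis ι ℝ H) (Φ : H →L[ℝ] LTwo Vec)

lemma IsCylindricalWiener.memLp_smul (hW : IsCylindricalWiener 𝓕 P W) (t : ℝ≥0) (k : ι) :
    MemLp (fun ω => W k t ω • Φ (e k)) 2 P :=
  (ContinuousLinearMap.toSpanSingleton ℝ (Φ (e k))).comp_memLp' (hW.memLp k t)

lemma IsCylindricalWiener.coeFn_noiseTerm (hW : IsCylindricalWiener 𝓕 P W) (t : ℝ≥0) (k : ι) :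
    noiseTerm P e Φ W t k =ᵐ[P] fun ω => W k t ω • Φ (e k) := by
  rw [noiseTerm, dif_pos (hW.memLp_smul e Φ t k)]
  exact MemLp.coeFn_toLp _

open Classical in
lemma IsCylindricalWiener.inner_noiseTerm [IsProbabilityMeasure P]
    (hW : IsCylindricalWiener 𝓕 P W) (s t : ℝ≥0) (k l : ι) :
    inner ℝ (noiseTerm P e Φ W s k) (noiseTerm P e Φ W t l) =
      (if k = l then ((min s t : ℝ≥0) : ℝ) else 0) * inner ℝ (Φ (e k)) (Φ (e l)) := by
  rw [L2.inner_def, ← hW.integral_mul, ← integral_mul_const]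
  refine integral_congr_ae ?_
  filter_upwards [hW.coeFn_noiseTerm e Φ s k, hW.coeFn_noiseTerm e Φ t l] with ω h1 h2
  rw [h1, h2, real_inner_smul_left, inner_smul_right, mul_assoc]

lemma summable_norm_sq_of_tsum_sobolevSq {Φ : H →L[ℝ] LTwo Vec} {e : HilbertBasis ι ℝ H} {m : ℕ}
    (hΦ : ∑' k, sobolevSq m (Φ (e k)) < ∞) : Summable fun k => ‖Φ (e k)‖ ^ 2 := by
  have h : ∑' k, ENNReal.ofReal (‖Φ (e k)‖ ^ 2) ≠ ∞ :=
    ((ENNReal.tsum_le_tsum fun k => by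
      rw [← enorm_sq_eq_ofReal]; exact enorm_sq_le_sobolevSq m _).trans_lt hΦ).ne
  exact (ENNReal.summable_toReal h).congr fun k => ENNReal.toReal_ofReal (sq_nonneg _)

variable {e Φ}

/-- Independence makes the terms orthogonal in `L²(Ω; L²)`, so square summability of their norms is
enough. Without convergence the series defining `noise` would have the default value zero. -/
lemma IsCylindricalWiener.summable_noiseTerm [IsProbabilityMeasure P] (hW : IsCylindricalWiener 𝓕 P W)
    (hΦ : Summable fun k => ‖Φ (e k)‖ ^ 2) (t : ℝ≥0) :
    Summable (noiseTerm P e Φ W t) := by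
  classical
  refine summable_of_pairwise_orthogonal (fun k l hkl => ?_) ((hΦ.mul_left (t : ℝ)).congr fun k => ?_)
  · exact (hW.inner_noiseTerm e Φ t t k l).trans (by rw [if_neg hkl, zero_mul])
  · rw [← real_inner_self_eq_norm_sq (noiseTerm P e Φ W t k), hW.inner_noiseTerm, if_pos rfl,
      real_inner_self_eq_norm_sq, min_self]

variable (e Φ) in
/-- The variance per unit time of the component of the noise in the direction `φ`. -/
def noiseVar (φ : LTwo Vec) : ℝ := ∑' k, inner ℝ (Φ (e k)) φ ^ 2

lemma noiseVar_nonneg (φ : LTwo Vec) : 0 ≤ noiseVar e Φ φ := tsum_nonneg fun _ => sq_nonneg _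

lemma memLp_inner_noise (t : ℝ≥0) (φ : LTwo Vec) :
    MemLp (fun ω => inner ℝ (noise P e Φ W t ω) φ) 2 P := by
  have := (innerSL ℝ φ : LTwo Vec →L[ℝ] ℝ).comp_memLp (∑' k, noiseTerm P e Φ W t k)
  refine this.ae_eq (Filter.Eventually.of_forall fun ω => ?_)
  exact real_inner_comm (noise P e Φ W t ω) φ

/-- Pairing with `φ` is a bounded operator from `L²(Ω; L²)` to `L²(Ω)`, so it passes through the
series, and the orthogonality of the `W k` leaves only diagonal terms. This covariance is all that
the error analysis uses about the noise. -/
lemma IsCylindricalWiener.integral_inner_noise_mul [IsProbabilityMeasure P]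
    (hW : IsCylindricalWiener 𝓕 P W) (hΦ : Summable fun k => ‖Φ (e k)‖ ^ 2) (s t : ℝ≥0)
    (φ : LTwo Vec) :
    ∫ ω, inner ℝ (noise P e Φ W s ω) φ * inner ℝ (noise P e Φ W t ω) φ ∂P =
      noiseVar e Φ φ * ((min s t : ℝ≥0) : ℝ) := by
  classical
  set L := ContinuousLinearMap.compLpL 2 P (innerSL ℝ φ : LTwo Vec →L[ℝ] ℝ)
  have hL : ∀ X : Lp (LTwo Vec) 2 P, L X =ᵐ[P] fun ω => inner ℝ (X ω) φ := fun X => by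
    filter_upwards [ContinuousLinearMap.coeFn_compLpL (innerSL ℝ φ : LTwo Vec →L[ℝ] ℝ) X] with ω h
    rw [h]
    exact real_inner_comm (X ω) φ
  have hT : ∀ s t k l, inner ℝ (L (noiseTerm P e Φ W s k)) (L (noiseTerm P e Φ W t l)) =
      (if k = l then ((min s t : ℝ≥0) : ℝ) else 0) *
        (inner ℝ (Φ (e k)) φ * inner ℝ (Φ (e l)) φ) := by
    intro s t k l
    rw [L2.inner_def, ← hW.integral_mul, ← integral_mul_const]
    refine integral_congr_ae ?_
    filter_upwards [hL (noiseTerm P e Φ W s k), hL (noiseTerm P e Φ W t l),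
      hW.coeFn_noiseTerm e Φ s k, hW.coeFn_noiseTerm e Φ t l] with ω h1 h2 h3 h4
    rw [h1, h2, h3, h4, real_inner_smul_left, real_inner_smul_left]
    simp only [RCLike.inner_apply, conj_trivial]
    ring
  have h1 : ∀ l, inner ℝ (L (∑' k, noiseTerm P e Φ W s k)) (L (noiseTerm P e Φ W t l)) =
      ((min s t : ℝ≥0) : ℝ) * inner ℝ (Φ (e l)) φ ^ 2 := fun l => by
    have h2 := ((innerSL ℝ (L (noiseTerm P e Φ W t l)) : Lp ℝ 2 P →L[ℝ] ℝ).comp L).hasSum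
      (hW.summable_noiseTerm hΦ s).hasSum
    have h3 : HasSum (fun k => inner ℝ (L (noiseTerm P e Φ W t l)) (L (noiseTerm P e Φ W s k)))
      (inner ℝ (L (noiseTerm P e Φ W t l)) (L (∑' k, noiseTerm P e Φ W s k))) := h2
    rw [real_inner_comm, ← h3.tsum_eq, tsum_eq_single l]
    · rw [hT, if_pos rfl, min_comm, sq]
    · intro k hk
      rw [hT, if_neg hk.symm, zero_mul]
  have h2 : HasSum (fun l => inner ℝ (L (∑' k, noiseTerm P e Φ W s k))
      (L (noiseTerm P e Φ W t l))) (inner ℝ (L (∑' k, noiseTerm P e Φ W s k))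
      (L (∑' k, noiseTerm P e Φ W t k))) :=
    ((innerSL ℝ (L (∑' k, noiseTerm P e Φ W s k)) : Lp ℝ 2 P →L[ℝ] ℝ).comp L).hasSum (hW.summable_noiseTerm hΦ t).hasSum
  simp_rw [h1] at h2
  rw [noiseVar, mul_comm, ← tsum_mul_left, h2.tsum_eq, L2.inner_def]
  refine integral_congr_ae ?_
  filter_upwards [hL (∑' k, noiseTerm P e Φ W s k), hL (∑' k, noiseTerm P e Φ W t k)] with ω h3 h4
  rw [h3, h4]
  simp only [noise, RCLike.inner_apply, conj_trivial]
  ring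

lemma summable_inner_sq (hΦ : Summable fun k => ‖Φ (e k)‖ ^ 2) (φ : LTwo Vec) :
    Summable fun k => inner ℝ (Φ (e k)) φ ^ 2 :=
  (hΦ.mul_right (‖φ‖ ^ 2)).of_nonneg_of_le (fun _ => sq_nonneg _) fun k => by
    rw [← mul_pow, ← sq_abs]
    gcongr
    exact abs_real_inner_le_norm _ _

lemma ofReal_noiseVar (hΦ : Summable fun k => ‖Φ (e k)‖ ^ 2) (φ : LTwo Vec) :
    ENNReal.ofReal (noiseVar e Φ φ) = ∑' k, ENNReal.ofReal (inner ℝ (Φ (e k)) φ ^ 2) :=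
  ENNReal.ofReal_tsum_of_nonneg (fun _ => sq_nonneg _) (summable_inner_sq hΦ φ)

/-- Pointwise `λ ≤ 1 + λ³` for `λ ≥ 0`. -/
lemma tsum_eigen_mul_energy_le (v : LTwo Vec) :
    ∑' ξ, ENNReal.ofReal (eigen ξ * energy ξ v) ≤ 2 * sobolevSq 3 v := by
  have h : ∀ ξ, ENNReal.ofReal (eigen ξ * energy ξ v) ≤ ENNReal.ofReal (energy ξ v) +
      ENNReal.ofReal (eigen ξ ^ 3 * energy ξ v) := fun ξ => by
    rw [← ENNReal.ofReal_add (energy_nonneg ξ v)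
      (mul_nonneg (pow_nonneg (eigen_nonneg ξ) 3) (energy_nonneg ξ v))]
    refine ENNReal.ofReal_le_ofReal ?_
    have h1 : eigen ξ ≤ 1 + eigen ξ ^ 3 := by
      nlinarith [eigen_nonneg ξ, sq_nonneg (eigen ξ - 1), mul_nonneg (eigen_nonneg ξ)
        (sq_nonneg (eigen ξ - 1))]
    nlinarith [energy_nonneg ξ v]
  refine (ENNReal.tsum_le_tsum h).trans ?_
  rw [ENNReal.tsum_add, two_mul, ← enorm_sq_eq_tsum]
  exact add_le_add (enorm_sq_le_sobolevSq 3 v) (tsum_le_sobolevSq 3 v)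

lemma energy_eq_sum_inner (v : LTwo Vec) (ξ : Fin 2 → ℤ) : energy ξ v =
    ∑ jb : Fin 2 × Bool, inner ℝ v (waveField ξ jb.2 (EuclideanSpace.single jb.1 (1 : ℝ))) ^ 2 := by
  rw [Fintype.sum_prod_type, Finset.sum_comm]
  simp [energy, inner_waveField, EuclideanSpace.norm_sq_eq, EuclideanSpace.inner_single_right]

lemma lintegral_inner_noise_sq [IsProbabilityMeasure P] (hW : IsCylindricalWiener 𝓕 P W)
    (hΦ : Summable fun k => ‖Φ (e k)‖ ^ 2) (t : ℝ≥0) (φ : LTwo Vec) :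
    ∫⁻ ω, ENNReal.ofReal (inner ℝ (noise P e Φ W t ω) φ ^ 2) ∂P =
      t * ∑' k, ENNReal.ofReal (inner ℝ (Φ (e k)) φ ^ 2) := by
  have h := hW.integral_inner_noise_mul hΦ t t φ
  simp_rw [← sq, min_self] at h
  rw [← ofReal_integral_eq_lintegral_ofReal (memLp_inner_noise t φ).integrable_sq
    (Filter.Eventually.of_forall fun ω => sq_nonneg _), h, ENNReal.ofReal_mul (noiseVar_nonneg φ),
    ofReal_noiseVar hΦ, mul_comm, ENNReal.ofReal_coe_nnreal]

/-- The expected weighted energy of the noise equals `t` times that of the columns of `Φ`, which is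
finite; hence the random weighted energy is almost surely finite. -/
lemma IsCylindricalWiener.memSobolev_noise [IsProbabilityMeasure P] [Countable ι]
    (hW : IsCylindricalWiener 𝓕 P W) (hΦ : ∑' k, sobolevSq 3 (Φ (e k)) < ∞) (t : ℝ≥0) :
    ∀ᵐ ω ∂P, MemSobolev 1 (noise P e Φ W t ω) := by
  have hΦ' := summable_norm_sq_of_tsum_sobolevSq hΦ
  have hm : ∀ φ : LTwo Vec,
      AEMeasurable (fun ω => ENNReal.ofReal (inner ℝ (noise P e Φ W t ω) φ ^ 2)) P := fun φ =>
    ((memLp_inner_noise t φ).1.aemeasurable.pow_const 2).ennreal_ofReal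
  have he : ∀ ξ (v : LTwo Vec), ENNReal.ofReal (eigen ξ * energy ξ v) =
      ENNReal.ofReal (eigen ξ) * ∑ jb : Fin 2 × Bool, ENNReal.ofReal
        (inner ℝ v (waveField ξ jb.2 (EuclideanSpace.single jb.1 (1 : ℝ))) ^ 2) := fun ξ v => by
    rw [ENNReal.ofReal_mul (eigen_nonneg ξ), energy_eq_sum_inner,
      ENNReal.ofReal_sum_of_nonneg fun _ _ => sq_nonneg _]
  have hm' : ∀ ξ, AEMeasurable
      (fun ω => ENNReal.ofReal (eigen ξ * energy ξ (noise P e Φ W t ω))) P := fun ξ => by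
    simp_rw [he]
    exact (Finset.aemeasurable_fun_sum _ fun jb _ => hm _).const_mul _
  have key : ∫⁻ ω, ∑' ξ, ENNReal.ofReal (eigen ξ * energy ξ (noise P e Φ W t ω)) ∂P =
      t * ∑' k, ∑' ξ, ENNReal.ofReal (eigen ξ * energy ξ (Φ (e k))) := by
    rw [lintegral_tsum hm', ENNReal.tsum_comm, ← ENNReal.tsum_mul_left]
    congr 1
    funext ξ
    simp_rw [he]
    rw [lintegral_const_mul'' _ (Finset.aemeasurable_fun_sum _ fun jb _ => hm _),
      lintegral_finsetSum' _ fun jb _ => hm _, ENNReal.tsum_mul_left, mul_left_comm]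
    congr 1
    simp_rw [lintegral_inner_noise_sq hW hΦ', ← Finset.mul_sum]
    rw [Summable.tsum_finsetSum fun i _ => ENNReal.summable]
  have hfin : ∫⁻ ω, ∑' ξ, ENNReal.ofReal (eigen ξ * energy ξ (noise P e Φ W t ω)) ∂P ≠ ∞ := by
    rw [key]
    refine ENNReal.mul_ne_top ENNReal.coe_ne_top (ne_top_of_le_ne_top ?_
      (ENNReal.tsum_le_tsum fun k => tsum_eigen_mul_energy_le _))
    rw [ENNReal.tsum_mul_left]
    exact ENNReal.mul_ne_top (by simp) hΦ.ne
  filter_upwards [ae_lt_top' (AEMeasurable.tsum hm') hfin] with ω hω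
  exact memSobolev_one_of_tsum_ne_top hω.ne

end Noise

/-! ### The equation of one mode along a path -/

section Deterministic

/-- Weighted Cauchy–Schwarz, from the nonnegativity of `∫ w (f - m/K)²` with `m = ∫ w f`. Any upper
bound `K` for the mass of the weight will do. -/
lemma sq_integral_mul_le {w f : ℝ → ℝ} (hw : Continuous w) (hf : Continuous f) {p q K : ℝ}
    (hpq : p ≤ q) (hw0 : ∀ s, 0 ≤ w s) (hK : 0 < K) (hwK : ∫ s in p..q, w s ≤ K) :
    (∫ s in p..q, w s * f s) ^ 2 ≤ K * ∫ s in p..q, w s * f s ^ 2 := by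
  set m := ∫ s in p..q, w s * f s with hm
  have h0 : 0 ≤ ∫ s in p..q, w s * (f s - m / K) ^ 2 :=
    intervalIntegral.integral_nonneg hpq fun s _ => mul_nonneg (hw0 s) (sq_nonneg _)
  have h1 : ∫ s in p..q, w s * (f s - m / K) ^ 2 = (∫ s in p..q, w s * f s ^ 2) -
      2 * (m / K) * m + (m / K) ^ 2 * ∫ s in p..q, w s := by
    rw [hm, ← intervalIntegral.integral_const_mul, ← intervalIntegral.integral_const_mul,
      ← intervalIntegral.integral_sub, ← intervalIntegral.integral_add]
    · congr 1
      funext s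
      ring
    all_goals exact Continuous.intervalIntegrable (by fun_prop) _ _
  rw [h1] at h0
  have h2 : (m / K) ^ 2 * ∫ s in p..q, w s ≤ (m / K) ^ 2 * K := by gcongr
  have h3 : 2 * (m / K) * m = 2 * (m ^ 2 / K) := by ring
  have h4 : (m / K) ^ 2 * K = m ^ 2 / K := by field_simp
  have h5 : m ^ 2 / K ≤ ∫ s in p..q, w s * f s ^ 2 := by linarith
  rwa [div_le_iff₀ hK, mul_comm] at h5

lemma sq_integral_le {f : ℝ → ℝ} (hf : Continuous f) {p q : ℝ} (hpq : p ≤ q) :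
    (∫ s in p..q, f s) ^ 2 ≤ (q - p) * ∫ s in p..q, f s ^ 2 := by
  rcases hpq.eq_or_lt with rfl | h
  · simp
  · simpa using sq_integral_mul_le continuous_const hf hpq (fun _ => zero_le_one) (sub_pos.2 h)
      (by simp)

/-- The noise that drives the path `x` of the equation `dx = -a x dt + dy`. -/
def drive (a : ℝ) (x : ℝ → ℝ) (t : ℝ) : ℝ := x t - x 0 + a * ∫ s in 0..t, x s

variable {a : ℝ} {x : ℝ → ℝ}

lemma drive_zero : drive a x 0 = 0 := by simp [drive]

lemma continuous_drive (hx : Continuous x) : Continuous (drive a x) := by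
  unfold drive
  have := intervalIntegral.continuous_primitive (μ := volume)
    (fun p q => hx.intervalIntegrable p q) 0
  fun_prop

lemma hasDerivAt_primitive (hx : Continuous x) (t : ℝ) :
    HasDerivAt (fun t => ∫ s in 0..t, x s) (x t) t :=
  intervalIntegral.integral_hasDerivAt_right (hx.intervalIntegrable _ _)
    (hx.stronglyMeasurableAtFilter _ _) hx.continuousAt

lemma hasDerivAt_exp_mul (a t : ℝ) :
    HasDerivAt (fun t => Real.exp (a * t)) (a * Real.exp (a * t)) t := by
  simpa [mul_comm] using ((hasDerivAt_id t).const_mul a).exp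

lemma drive_sub (hx : Continuous x) (p q : ℝ) :
    drive a x q - drive a x p = x q - x p + a * ∫ s in p..q, x s := by
  have h := intervalIntegral.integral_interval_sub_left (hx.intervalIntegrable (μ := volume) 0 q)
    (hx.intervalIntegrable 0 p)
  rw [drive, drive, ← h]
  ring

/-- Variation of constants with the integral against `dy` integrated by parts, so that it makes
sense path by path. Writing it with `y(t) - y(s)` lets the exponential weight act on short
increments, which yields bounds that improve with `a`. -/
lemma mild_formula (hx : Continuous x) (t : ℝ) :
    x t = Real.exp (-(a * t)) * x 0 + Real.exp (-(a * t)) * drive a x t +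
      ∫ s in 0..t, (a * Real.exp (-(a * (t - s)))) * (drive a x t - drive a x s) := by
  have hy := continuous_drive (a := a) hx
  -- The function `x 0 - a ∫ x` equals `x - y` and is differentiable, unlike `x` and `y` separately;
  -- multiplying by `exp (a s)` removes the damping.
  have hd : ∀ s ∈ Set.uIcc 0 t,
      HasDerivAt (fun s => Real.exp (a * s) * (x 0 - a * ∫ r in 0..s, x r))
      (-(a * (Real.exp (a * s) * drive a x s))) s := by
    intro s _
    refine ((hasDerivAt_exp_mul a s).mul
      (((hasDerivAt_primitive hx s).const_mul a).const_sub (x 0))).congr_deriv ?_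
    rw [drive]
    ring
  have h1 := intervalIntegral.integral_eq_sub_of_hasDerivAt hd
    (Continuous.intervalIntegrable (by fun_prop) _ _)
  have h2 : ∫ s in 0..t, a * Real.exp (a * s) = Real.exp (a * t) - 1 := by
    rw [intervalIntegral.integral_eq_sub_of_hasDerivAt (fun s _ => hasDerivAt_exp_mul a s)
      (Continuous.intervalIntegrable (by fun_prop) _ _)]
    simp
  have h3 : ∫ s in 0..t, (a * Real.exp (-(a * (t - s)))) * (drive a x t - drive a x s) =
      Real.exp (-(a * t)) * (drive a x t * (∫ s in 0..t, a * Real.exp (a * s)) +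
        ∫ s in 0..t, -(a * (Real.exp (a * s) * drive a x s))) := by
    rw [← intervalIntegral.integral_const_mul, ← intervalIntegral.integral_add,
      ← intervalIntegral.integral_const_mul]
    · congr 1
      funext s
      have : Real.exp (-(a * (t - s))) = Real.exp (-(a * t)) * Real.exp (a * s) := by
        rw [← Real.exp_add]; ring_nf
      rw [this]
      ring
    all_goals exact Continuous.intervalIntegrable (by fun_prop) _ _
  have h4 : Real.exp (-(a * t)) * Real.exp (a * t) = 1 := by rw [← Real.exp_add]; simp
  rw [h3, h1, h2]
  simp only [intervalIntegral.integral_same, mul_zero, Real.exp_zero, sub_zero, one_mul]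
  have h5 : drive a x t = x t - (x 0 - a * ∫ s in 0..t, x s) := by rw [drive]; ring
  linear_combination (-drive a x t - (x 0 - a * ∫ s in 0..t, x s)) * h4 - h5

lemma integral_mul_exp_sub (ha : a ≠ 0) (t : ℝ) :
    ∫ s in 0..t, a * Real.exp (-(a * (t - s))) * (t - s) =
      1 / a - (t + 1 / a) * Real.exp (-(a * t)) := by
  have hd : ∀ s ∈ Set.uIcc 0 t, HasDerivAt
      (fun s => (t - s + 1 / a) * Real.exp (-(a * (t - s))))
      (a * Real.exp (-(a * (t - s))) * (t - s)) s := by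
    intro s _
    have h1 : HasDerivAt (fun s : ℝ => -(a * (t - s))) a s := by
      simpa using! (((hasDerivAt_id s).const_sub t).const_mul a).neg
    refine ((((hasDerivAt_id s).const_sub t).add_const (1 / a)).mul h1.exp).congr_deriv ?_
    simp only [id]
    field_simp
    ring
  rw [intervalIntegral.integral_eq_sub_of_hasDerivAt hd
    (Continuous.intervalIntegrable (by fun_prop) _ _)]
  simp

lemma integral_exp_sub_le (t : ℝ) : ∫ s in 0..t, a * Real.exp (-(a * (t - s))) ≤ 1 := by
  have hd : ∀ s ∈ Set.uIcc 0 t, HasDerivAt (fun s => Real.exp (-(a * (t - s))))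
      (a * Real.exp (-(a * (t - s)))) s := by
    intro s _
    have h1 : HasDerivAt (fun s : ℝ => -(a * (t - s))) a s := by
      simpa using! (((hasDerivAt_id s).const_sub t).const_mul a).neg
    simpa [mul_comm] using h1.exp
  rw [intervalIntegral.integral_eq_sub_of_hasDerivAt hd
    (Continuous.intervalIntegrable (by fun_prop) _ _)]
  simp [Real.exp_nonneg]

lemma sq_le_of_mild (hx : Continuous x) (ha : 0 < a) {t : ℝ} (ht : 0 ≤ t) :
    x t ^ 2 ≤ 3 * Real.exp (-(2 * a * t)) * x 0 ^ 2 +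
      (3 * Real.exp (-(2 * a * t)) * drive a x t ^ 2 +
      3 * ∫ s in 0..t, (a * Real.exp (-(a * (t - s)))) * (drive a x t - drive a x s) ^ 2) := by
  have hy := continuous_drive (a := a) hx
  have h1 := sq_integral_mul_le (w := fun s => a * Real.exp (-(a * (t - s))))
    (f := fun s => drive a x t - drive a x s) (by fun_prop) (by fun_prop) ht
    (fun s => by positivity) one_pos (integral_exp_sub_le t)
  have h2 : Real.exp (-(2 * a * t)) = Real.exp (-(a * t)) ^ 2 := by
    rw [← Real.exp_nat_mul]; ring_nf
  rw [mild_formula (a := a) hx t, h2]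
  set A := Real.exp (-(a * t)) * x 0
  set B := Real.exp (-(a * t)) * drive a x t
  set D := ∫ s in 0..t, (a * Real.exp (-(a * (t - s)))) * (drive a x t - drive a x s)
  have h3 : (A + B + D) ^ 2 ≤ 3 * (A ^ 2 + B ^ 2 + D ^ 2) := by
    nlinarith [sq_nonneg (A - B), sq_nonneg (A - D), sq_nonneg (B - D)]
  have h4 : A ^ 2 = Real.exp (-(a * t)) ^ 2 * x 0 ^ 2 := mul_pow _ _ 2
  have h5 : B ^ 2 = Real.exp (-(a * t)) ^ 2 * drive a x t ^ 2 := mul_pow _ _ 2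
  linarith

/-- Trapezoidal rule for `x - y`, whose derivative is `-a x`, with the Peano kernel `s - midpoint`.
The kernel has mean zero, so any constant may be subtracted from `x`. -/
lemma trapezoid_identity (hx : Continuous x) (p q c I : ℝ) :
    (∫ s in p..q, x s) - (q - p) * ((x p + x q) / 2) -
        (q - p) * (I - (drive a x q + drive a x p) / 2) =
      a * (∫ s in p..q, (s - (p + q) / 2) * (x s - c)) +
        ((∫ s in p..q, drive a x s) - (q - p) * I) := by
  have hy := continuous_drive (a := a) hx
  have hF : Continuous fun t => ∫ s in 0..t, x s :=
    intervalIntegral.continuous_primitive (μ := volume) (fun p q => hx.intervalIntegrable p q) 0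
  -- The term with `c` takes the same value at both endpoints, being even about the midpoint, and so
  -- drops out.
  have hd : ∀ s ∈ Set.uIcc p q, HasDerivAt
      (fun s => (s - (p + q) / 2) * (x 0 - a * ∫ r in 0..s, x r) + c * a * (s - (p + q) / 2) ^ 2 / 2)
      (x s - drive a x s - a * ((s - (p + q) / 2) * (x s - c))) s := by
    intro s _
    have h1 := (hasDerivAt_id s).sub_const ((p + q) / 2)
    refine ((h1.mul (((hasDerivAt_primitive hx s).const_mul a).const_sub (x 0))).add
      (((h1.pow 2).const_mul (c * a)).div_const 2)).congr_deriv ?_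
    simp only [drive, id]
    ring
  have h1 := intervalIntegral.integral_eq_sub_of_hasDerivAt hd
    (Continuous.intervalIntegrable (by fun_prop) _ _)
  rw [intervalIntegral.integral_sub, intervalIntegral.integral_sub,
    intervalIntegral.integral_const_mul] at h1
  · simp only [drive] at h1 ⊢
    linear_combination h1
  all_goals exact Continuous.intervalIntegrable (by fun_prop) _ _

/-- The local error of the scheme in one mode. -/
def localError (a : ℝ) (x : ℝ → ℝ) (p q I : ℝ) : ℝ :=
  (∫ s in p..q, x s) - (q - p) * ((x p + x q) / 2) -
    (q - p) * (I - (drive a x q + drive a x p) / 2)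

/-- The kernel is at most half the interval length; the factor `1/2` is this `1/4` times the `2` of
`(A + D)² ≤ 2A² + 2D²`. The constant `c` stays free because its good choice depends on the
stiffness. -/
lemma sq_localError_le (hx : Continuous x) {p q : ℝ} (hpq : p ≤ q) (c I : ℝ) :
    localError a x p q I ^ 2 ≤ a ^ 2 * (q - p) ^ 3 / 2 * (∫ s in p..q, (x s - c) ^ 2) +
      2 * ((∫ s in p..q, drive a x s) - (q - p) * I) ^ 2 := by
  rw [localError, trapezoid_identity hx p q c I]
  have h1 := sq_integral_le (f := fun s => (s - (p + q) / 2) * (x s - c)) (by fun_prop) hpq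
  have h2 : ∫ s in p..q, ((s - (p + q) / 2) * (x s - c)) ^ 2 ≤
      (q - p) ^ 2 / 4 * ∫ s in p..q, (x s - c) ^ 2 := by
    rw [← intervalIntegral.integral_const_mul]
    refine intervalIntegral.integral_mono_on hpq
      (Continuous.intervalIntegrable (by fun_prop) _ _)
      (Continuous.intervalIntegrable (by fun_prop) _ _) fun s hs => ?_
    rw [mul_pow]
    refine mul_le_mul_of_nonneg_right ?_ (sq_nonneg _)
    nlinarith [hs.1, hs.2]
  have h3 := mul_le_mul_of_nonneg_left h2 (sub_nonneg.2 hpq)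
  have h4 := mul_le_mul_of_nonneg_left (h1.trans h3) (mul_nonneg zero_le_two (sq_nonneg a))
  set D := (∫ s in p..q, drive a x s) - (q - p) * I
  set A := ∫ s in p..q, (s - (p + q) / 2) * (x s - c)
  nlinarith [sq_nonneg (a * A - D)]

lemma sq_sub_le (hx : Continuous x) {p s q : ℝ} (hps : p ≤ s) (hsq : s ≤ q) :
    (x s - x p) ^ 2 ≤ 2 * a ^ 2 * (q - p) * (∫ r in p..q, x r ^ 2) +
      2 * (drive a x s - drive a x p) ^ 2 := by
  have h1 : x s - x p = (drive a x s - drive a x p) - a * ∫ r in p..s, x r := by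
    rw [drive_sub hx]; ring
  have h2 : (∫ r in p..s, x r) ^ 2 ≤ (q - p) * ∫ r in p..q, x r ^ 2 := by
    refine (sq_integral_le hx hps).trans ?_
    have h3 : ∫ r in p..s, x r ^ 2 ≤ ∫ r in p..q, x r ^ 2 := by
      refine intervalIntegral.integral_mono_interval le_rfl hps hsq
        (Filter.Eventually.of_forall fun r => sq_nonneg _)
        (Continuous.intervalIntegrable (by fun_prop) _ _)
    have h4 : 0 ≤ ∫ r in p..s, x r ^ 2 :=
      intervalIntegral.integral_nonneg hps fun r _ => sq_nonneg _
    gcongr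
    linarith
  rw [h1]
  have h3 := mul_le_mul_of_nonneg_left h2 (mul_nonneg zero_le_two (sq_nonneg a))
  set A := ∫ r in p..s, x r
  set D := drive a x s - drive a x p
  nlinarith [sq_nonneg (a * A + D)]

lemma integral_sq_sub_le (hx : Continuous x) {p q : ℝ} (hpq : p ≤ q) :
    ∫ s in p..q, (x s - x p) ^ 2 ≤ 2 * a ^ 2 * (q - p) ^ 2 * (∫ r in p..q, x r ^ 2) +
      2 * ∫ s in p..q, (drive a x s - drive a x p) ^ 2 := by
  have hy := continuous_drive (a := a) hx
  have h : ∫ s in p..q, (x s - x p) ^ 2 ≤ ∫ s in p..q,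
      (2 * a ^ 2 * (q - p) * (∫ r in p..q, x r ^ 2) +
      2 * (drive a x s - drive a x p) ^ 2) :=
    intervalIntegral.integral_mono_on hpq
      (Continuous.intervalIntegrable (by fun_prop) _ _)
      (Continuous.intervalIntegrable (by fun_prop) _ _) fun s hs => sq_sub_le hx hs.1 hs.2
  refine h.trans (le_of_eq ?_)
  rw [intervalIntegral.integral_add, intervalIntegral.integral_const,
    intervalIntegral.integral_const_mul]
  · simp only [smul_eq_mul]; ring
  all_goals exact Continuous.intervalIntegrable (by fun_prop) _ _

/-- The energy estimate for the error of the Crank–Nicolson scheme in one mode. -/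
lemma energy_estimate (hx : Continuous x) (ha : 0 ≤ a) {τ : ℝ} (hτ : 0 < τ) {V I : ℕ → ℝ}
    {N : ℕ} (h0 : V 0 = x 0)
    (hV : ∀ n < N, V (n + 1) - V n + a * τ * ((V n + V (n + 1)) / 2 +
      (I n - (drive a x ((n + 1 : ℕ) * τ) + drive a x (n * τ)) / 2)) =
        drive a x ((n + 1 : ℕ) * τ) - drive a x (n * τ)) {n : ℕ} (hn : n ≤ N) :
    (x (n * τ) - V n) ^ 2 + a * τ * ∑ m ∈ Finset.range n,
        ((x (m * τ) + x ((m + 1 : ℕ) * τ)) / 2 - (V m + V (m + 1)) / 2) ^ 2 ≤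
      a / τ * ∑ m ∈ Finset.range n, localError a x (m * τ) ((m + 1 : ℕ) * τ) (I m) ^ 2 := by
  induction n with
  | zero => simp [h0]
  | succ n ih =>
    have h1 := ih (Nat.le_of_succ_le hn)
    have h2 := hV n hn
    have h3 := drive_sub (a := a) hx (n * τ) ((n + 1 : ℕ) * τ)
    rw [Finset.sum_range_succ, Finset.sum_range_succ]
    have h4 : ((n + 1 : ℕ) : ℝ) * τ - n * τ = τ := by push_cast; ring
    set p := (n : ℝ) * τ
    set q := ((n + 1 : ℕ) : ℝ) * τ
    set R := localError a x p q (I n) with hR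
    rw [localError, h4] at hR
    set E := (x p + x q) / 2 - (V n + V (n + 1)) / 2 with hE
    have h5 : (x q - V (n + 1)) - (x p - V n) = -(a * τ * E) - a * R := by
      rw [hR, hE]
      linear_combination -h2 - h3
    have h6 : (x q - V (n + 1)) + (x p - V n) = 2 * E := by rw [hE]; ring
    have h7 : (x q - V (n + 1)) ^ 2 - (x p - V n) ^ 2 = 2 * E * (-(a * τ * E) - a * R) := by
      rw [← h5, ← h6]; ring
    -- Completing the square absorbs the cross term into half of the dissipation `2 a τ E²`; the
    -- other half remains on the left of the estimate.
    have h8 : a / τ * R ^ 2 + a * τ * E ^ 2 + 2 * a * E * R = a / τ * (R + τ * E) ^ 2 := by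
      field_simp
      ring
    have h9 : 0 ≤ a / τ * (R + τ * E) ^ 2 := by positivity
    linarith

end Deterministic

/-! ### Processes with continuous paths -/

section ModeEquation

variable {Ω : Type*} [MeasurableSpace Ω] {P : Measure Ω}

/-- A measurable process all of whose paths are continuous. -/
structure ContProcess (X : ℝ → Ω → ℝ) : Prop where
  continuous : ∀ ω, Continuous fun t => X t ω
  measurable : ∀ t, Measurable (X t)

namespace ContProcess

variable {X Y : ℝ → Ω → ℝ}

lemma measurable_uncurry (hX : ContProcess X) : Measurable (Function.uncurry X) :=
  measurable_uncurry_of_continuous_of_measurable hX.continuous hX.measurable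

lemma measurable_integral (hX : ContProcess X) (p q : ℝ) :
    Measurable fun ω => ∫ s in p..q, X s ω := by
  have h := hX.measurable_uncurry.stronglyMeasurable
  unfold intervalIntegral
  exact (h.integral_prod_left'.measurable).sub (h.integral_prod_left'.measurable)

lemma primitive (hX : ContProcess X) (p : ℝ) : ContProcess fun t ω => ∫ s in p..t, X s ω :=
  ⟨fun ω => intervalIntegral.continuous_primitive (μ := volume)
    (fun _ _ => (hX.continuous ω).intervalIntegrable _ _) p, fun t => hX.measurable_integral p t⟩

lemma add (hX : ContProcess X) (hY : ContProcess Y) : ContProcess fun t ω => X t ω + Y t ω :=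
  ⟨fun ω => (hX.continuous ω).add (hY.continuous ω), fun t => (hX.measurable t).add (hY.measurable t)⟩

lemma sub (hX : ContProcess X) (hY : ContProcess Y) : ContProcess fun t ω => X t ω - Y t ω :=
  ⟨fun ω => (hX.continuous ω).sub (hY.continuous ω), fun t => (hX.measurable t).sub (hY.measurable t)⟩

lemma pow_two (hX : ContProcess X) : ContProcess fun t ω => X t ω ^ 2 :=
  ⟨fun ω => (hX.continuous ω).pow 2, fun t => (hX.measurable t).pow_const 2⟩

lemma mul_fun (hX : ContProcess X) {f : ℝ → ℝ} (hf : Continuous f) :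
    ContProcess fun t ω => f t * X t ω :=
  ⟨fun ω => hf.mul (hX.continuous ω), fun t => (hX.measurable t).const_mul (f t)⟩

lemma const {Z : Ω → ℝ} (hZ : Measurable Z) : ContProcess fun _ => Z :=
  ⟨fun _ => continuous_const, fun _ => hZ⟩

lemma drive (hX : ContProcess X) (a : ℝ) :
    ContProcess fun t ω => drive a (fun s => X s ω) t :=
  (hX.sub (const (hX.measurable 0))).add ((hX.primitive 0).mul_fun continuous_const)

end ContProcess

/-! ### Expectations of nonnegative quantities and exchange with time integrals -/

section Mean

lemma lintegral_ofReal_add_le {f g : Ω → ℝ} {c d : ℝ} (hf : AEMeasurable f P) (hc : 0 ≤ c)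
    (hd : 0 ≤ d) (h1 : ∫⁻ ω, ENNReal.ofReal (f ω) ∂P ≤ ENNReal.ofReal c)
    (h2 : ∫⁻ ω, ENNReal.ofReal (g ω) ∂P ≤ ENNReal.ofReal d) :
    ∫⁻ ω, ENNReal.ofReal (f ω + g ω) ∂P ≤ ENNReal.ofReal (c + d) := by
  rw [ENNReal.ofReal_add hc hd]
  refine (lintegral_mono fun ω => ENNReal.ofReal_add_le).trans ?_
  rw [lintegral_add_left' hf.ennreal_ofReal]
  exact add_le_add h1 h2

lemma lintegral_ofReal_mul_le {f : Ω → ℝ} {c k : ℝ} (hk : 0 ≤ k)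
    (h : ∫⁻ ω, ENNReal.ofReal (f ω) ∂P ≤ ENNReal.ofReal c) :
    ∫⁻ ω, ENNReal.ofReal (k * f ω) ∂P ≤ ENNReal.ofReal (k * c) := by
  simp_rw [ENNReal.ofReal_mul hk]
  rw [lintegral_const_mul' _ _ ENNReal.ofReal_ne_top]
  gcongr

lemma lintegral_ofReal_sum_le {f : ℕ → Ω → ℝ} {c : ℝ} {N : ℕ} (hf : ∀ n < N, Measurable (f n))
    (hc : 0 ≤ c)
    (h : ∀ n < N, ∫⁻ ω, ENNReal.ofReal (f n ω) ∂P ≤ ENNReal.ofReal c) :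
    ∫⁻ ω, ENNReal.ofReal (∑ n ∈ Finset.range N, f n ω) ∂P ≤ ENNReal.ofReal (N * c) := by
  induction N with
  | zero => simp
  | succ N ih =>
    simp_rw [Finset.sum_range_succ]
    push_cast
    rw [add_mul, one_mul]
    exact lintegral_ofReal_add_le
      (Finset.measurable_fun_sum _ fun n hn => hf n
        ((Finset.mem_range.1 hn).trans (Nat.lt_succ_self N))).aemeasurable (by positivity) hc
      (ih (fun n hn => hf n (hn.trans (Nat.lt_succ_self N)))
        fun n hn => h n (hn.trans (Nat.lt_succ_self N))) (h N (Nat.lt_succ_self N))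

/-- Tonelli's theorem; nonnegativity removes any need for prior integrability of the time integral
over `Ω`. -/
lemma lintegral_ofReal_integral_le [SFinite P] {g : ℝ → Ω → ℝ} (hg : ContProcess g)
    (hg0 : ∀ s ω, 0 ≤ g s ω) {p q : ℝ} (hpq : p ≤ q) {h : ℝ → ℝ} (hh : Continuous h)
    (h0 : ∀ s ∈ Set.Icc p q, 0 ≤ h s)
    (hb : ∀ s ∈ Set.Icc p q, ∫⁻ ω, ENNReal.ofReal (g s ω) ∂P ≤ ENNReal.ofReal (h s)) :
    ∫⁻ ω, ENNReal.ofReal (∫ s in p..q, g s ω) ∂P ≤ ENNReal.ofReal (∫ s in p..q, h s) := by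
  have e1 : ∀ ω, ENNReal.ofReal (∫ s in p..q, g s ω) =
      ∫⁻ s in Set.Ioc p q, ENNReal.ofReal (g s ω) := fun ω => by
    rw [intervalIntegral.integral_of_le hpq]
    exact ofReal_integral_eq_lintegral_ofReal
      (((hg.continuous ω).intervalIntegrable p q).1) (Filter.Eventually.of_forall fun s => hg0 s ω)
  simp_rw [e1]
  rw [lintegral_lintegral_swap (hg.measurable_uncurry.comp measurable_swap).ennreal_ofReal.aemeasurable,
    intervalIntegral.integral_of_le hpq,
    ofReal_integral_eq_lintegral_ofReal ((hh.intervalIntegrable p q).1)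
      ((ae_restrict_iff' measurableSet_Ioc).2
        (Filter.Eventually.of_forall fun s hs => h0 s (Set.Ioc_subset_Icc_self hs)))]
  exact setLIntegral_mono' measurableSet_Ioc fun s hs => hb s (Set.Ioc_subset_Icc_self hs)

lemma integral_mul_intervalIntegral [IsFiniteMeasure P] {g : ℝ → Ω → ℝ} (hg : ContProcess g)
    {G : Ω → ℝ} (hG : MemLp G 2 P) {p q K : ℝ} (hpq : p ≤ q)
    (hb : ∀ s ∈ Set.Icc p q, ∫⁻ ω, ENNReal.ofReal (g s ω ^ 2) ∂P ≤ ENNReal.ofReal K) :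
    ∫ ω, G ω * (∫ s in p..q, g s ω) ∂P = ∫ s in p..q, ∫ ω, G ω * g s ω ∂P := by
  simp_rw [← intervalIntegral.integral_const_mul]
  refine (intervalIntegral_integral_swap (f := fun s ω => G ω * g s ω) ?_).symm
  have hm : ∀ μ : Measure (ℝ × Ω), AEStronglyMeasurable (Function.uncurry g) μ := fun μ =>
    hg.measurable_uncurry.aestronglyMeasurable
  have : IsFiniteMeasure (volume.restrict (Set.uIoc p q)) := ⟨by simp [Set.uIoc_of_le hpq]⟩
  have h1 : MemLp (fun z : ℝ × Ω => G z.2) 2 ((volume.restrict (Set.uIoc p q)).prod P) :=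
    hG.comp_snd _
  have h2 : MemLp (Function.uncurry g) 2 ((volume.restrict (Set.uIoc p q)).prod P) := by
    refine (memLp_two_iff_integrable_sq (hm _)).2 ⟨(hg.measurable_uncurry.pow_const 2).aestronglyMeasurable, ?_⟩
    have e : ∀ z : ℝ × Ω, ‖Function.uncurry g z ^ 2‖ₑ = ENNReal.ofReal (Function.uncurry g z ^ 2) :=
      fun z => Real.enorm_of_nonneg (sq_nonneg _)
    rw [HasFiniteIntegral]
    simp_rw [e]
    rw [lintegral_prod _ (hg.measurable_uncurry.pow_const 2).ennreal_ofReal.aemeasurable,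
      Set.uIoc_of_le hpq]
    refine (setLIntegral_mono' measurableSet_Ioc
      fun s hs => hb s (Set.Ioc_subset_Icc_self hs)).trans_lt ?_
    simp [ENNReal.mul_lt_top_iff]
  exact h1.integrable_mul h2

lemma memLp_two_of_lintegral_le {f : Ω → ℝ} (hf : AEStronglyMeasurable f P) {c : ℝ}
    (h : ∫⁻ ω, ENNReal.ofReal (f ω ^ 2) ∂P ≤ ENNReal.ofReal c) : MemLp f 2 P := by
  refine (memLp_two_iff_integrable_sq hf).2 ⟨hf.pow 2, ?_⟩
  rw [HasFiniteIntegral]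
  refine lt_of_le_of_lt ?_ (h.trans_lt ENNReal.ofReal_lt_top)
  exact lintegral_mono fun ω => (Real.enorm_of_nonneg (sq_nonneg (f ω))).le

end Mean

/-- The coefficient of a solution in one mode: the noise that drives it is a Brownian motion
with variance `σ` per unit time, and the initial value has second moment at most `m`. -/
structure ModeProcess (P : Measure Ω) (a σ T m : ℝ) (X : ℝ → Ω → ℝ) : Prop
    extends ContProcess X where
  initial : ∫⁻ ω, ENNReal.ofReal (X 0 ω ^ 2) ∂P ≤ ENNReal.ofReal m
  memLp : ∀ t ∈ Set.Icc 0 T, MemLp (fun ω => drive a (fun s => X s ω) t) 2 P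
  cov : ∀ s ∈ Set.Icc 0 T, ∀ t ∈ Set.Icc 0 T,
    ∫ ω, drive a (fun s => X s ω) s * drive a (fun s => X s ω) t ∂P = σ * min s t

/-! ### Second moments of one mode -/

namespace ModeProcess

variable {a σ T m : ℝ} {X : ℝ → Ω → ℝ}

lemma integral_sub_mul_sub (hX : ModeProcess P a σ T m X) {r s t v : ℝ} (hr : r ∈ Set.Icc 0 T)
    (hs : s ∈ Set.Icc 0 T) (ht : t ∈ Set.Icc 0 T) (hv : v ∈ Set.Icc 0 T) :
    ∫ ω, (drive a (fun s => X s ω) r - drive a (fun s => X s ω) s) *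
      (drive a (fun s => X s ω) t - drive a (fun s => X s ω) v) ∂P =
        σ * (min r t - min r v - min s t + min s v) := by
  have hi : ∀ {s t}, s ∈ Set.Icc 0 T → t ∈ Set.Icc 0 T → Integrable (fun ω =>
      drive a (fun s => X s ω) s * drive a (fun s => X s ω) t) P := fun hs ht =>
    (hX.memLp _ hs).integrable_mul (hX.memLp _ ht)
  have e : ∀ ω, (drive a (fun s => X s ω) r - drive a (fun s => X s ω) s) *
      (drive a (fun s => X s ω) t - drive a (fun s => X s ω) v) =
      drive a (fun s => X s ω) r * drive a (fun s => X s ω) t -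
      drive a (fun s => X s ω) r * drive a (fun s => X s ω) v -
      drive a (fun s => X s ω) s * drive a (fun s => X s ω) t +
      drive a (fun s => X s ω) s * drive a (fun s => X s ω) v := fun ω => by ring
  simp_rw [e]
  have i1 := (hi hr ht).sub (hi hr hv)
  have i2 := i1.sub (hi hs ht)
  simp only [Pi.sub_def] at i1 i2
  rw [integral_add i2 (hi hs hv), integral_sub i1 (hi hs ht), integral_sub (hi hr ht) (hi hr hv),
    hX.cov r hr t ht, hX.cov r hr v hv, hX.cov s hs t ht, hX.cov s hs v hv]
  ring

lemma lintegral_sub_sq (hX : ModeProcess P a σ T m X) {s t : ℝ} (hs : s ∈ Set.Icc 0 T)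
    (ht : t ∈ Set.Icc 0 T) (hst : s ≤ t) :
    ∫⁻ ω, ENNReal.ofReal ((drive a (fun s => X s ω) t - drive a (fun s => X s ω) s) ^ 2) ∂P =
      ENNReal.ofReal (σ * (t - s)) := by
  have h := hX.integral_sub_mul_sub ht hs ht hs
  simp_rw [← sq] at h
  have hi := ((hX.memLp t ht).sub (hX.memLp s hs)).integrable_sq
  simp only [Pi.sub_apply] at hi
  rw [← ofReal_integral_eq_lintegral_ofReal hi (Filter.Eventually.of_forall fun ω => sq_nonneg _), h]
  simp [hst]

lemma lintegral_sub_sq' (hX : ModeProcess P a σ T m X) {s t : ℝ} (hs : s ∈ Set.Icc 0 T)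
    (ht : t ∈ Set.Icc 0 T) (hst : s ≤ t) :
    ∫⁻ ω, ENNReal.ofReal ((drive a (fun s => X s ω) s - drive a (fun s => X s ω) t) ^ 2) ∂P =
      ENNReal.ofReal (σ * (t - s)) := by
  simp_rw [← hX.lintegral_sub_sq hs ht hst, sub_sq_comm (drive a _ s)]

/-- Take second moments in the mild formula, using increments of variance `σ (t - s)`. The noise
contributes `(3/2 + 3) σ/a`, below `6 σ/a`. Keeping the exponential decay of the initial term is
what later gives a factor `1/a` after integration in time. -/
lemma lintegral_sq_le [SFinite P] (hX : ModeProcess P a σ T m X) (ha : 0 < a) (hσ : 0 ≤ σ)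
    (hm : 0 ≤ m) {t : ℝ} (ht : t ∈ Set.Icc 0 T) :
    ∫⁻ ω, ENNReal.ofReal (X t ω ^ 2) ∂P ≤
      ENNReal.ofReal (3 * Real.exp (-(2 * a * t)) * m + 6 * σ / a) := by
  have hY := hX.toContProcess.drive a
  have h0 : (0 : ℝ) ∈ Set.Icc 0 T := ⟨le_rfl, ht.1.trans ht.2⟩
  have h1 : ∫⁻ ω, ENNReal.ofReal (∫ s in 0..t, (a * Real.exp (-(a * (t - s)))) *
      (drive a (fun s => X s ω) t - drive a (fun s => X s ω) s) ^ 2) ∂P ≤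
      ENNReal.ofReal (∫ s in 0..t, (a * Real.exp (-(a * (t - s)))) * (σ * (t - s))) := by
    refine lintegral_ofReal_integral_le
      ((((ContProcess.const (hY.measurable t)).sub hY).pow_two).mul_fun (by fun_prop))
      (fun s ω => by positivity) ht.1 (by fun_prop) (fun s hs => ?_) (fun s hs => ?_)
    · have := sub_nonneg.2 hs.2
      positivity
    · exact lintegral_ofReal_mul_le (by positivity)
        (hX.lintegral_sub_sq ⟨hs.1, hs.2.trans ht.2⟩ ht hs.2).le
  have h2 : ∫ s in 0..t, (a * Real.exp (-(a * (t - s)))) * (σ * (t - s)) ≤ σ / a := by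
    have : ∀ s, (a * Real.exp (-(a * (t - s)))) * (σ * (t - s)) =
        σ * (a * Real.exp (-(a * (t - s))) * (t - s)) := fun s => by ring
    simp_rw [this]
    rw [intervalIntegral.integral_const_mul, integral_mul_exp_sub ha.ne', div_eq_mul_one_div σ]
    have : 0 ≤ (t + 1 / a) * Real.exp (-(a * t)) := by have := ht.1; positivity
    gcongr
    linarith
  have h3 : ∫⁻ ω, ENNReal.ofReal (drive a (fun s => X s ω) t ^ 2) ∂P ≤ ENNReal.ofReal (σ * t) := by
    have := hX.lintegral_sub_sq h0 ht ht.1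
    simpa [drive_zero] using this.le
  -- Here `t exp (-2at) ≤ 1/(2a)`, from `exp z ≥ z + 1`.
  have h4 : 3 * Real.exp (-(2 * a * t)) * (σ * t) ≤ 3 / 2 * (σ / a) := by
    have h5 := Real.add_one_le_exp (2 * a * t)
    have h6 : Real.exp (-(2 * a * t)) * Real.exp (2 * a * t) = 1 := by rw [← Real.exp_add]; simp
    have h7 : Real.exp (-(2 * a * t)) * t ≤ 1 / (2 * a) := by
      rw [le_div_iff₀ (by positivity), ← h6]
      have := Real.exp_pos (-(2 * a * t))
      nlinarith
    have h8 := mul_le_mul_of_nonneg_left h7 hσ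
    have h9 : σ * (1 / (2 * a)) = (σ / a) / 2 := by field_simp
    linarith
  have hσa : 0 ≤ σ / a := by positivity
  refine (lintegral_mono fun ω => ENNReal.ofReal_le_ofReal
    (sq_le_of_mild (hX.continuous ω) ha ht.1)).trans ?_
  refine lintegral_ofReal_add_le (((hX.measurable 0).pow_const 2).const_mul _).aemeasurable
    (by positivity) (by positivity) (lintegral_ofReal_mul_le (by positivity) hX.initial) ?_
  refine (lintegral_ofReal_add_le (((hY.measurable t).pow_const 2).const_mul _).aemeasurable
    (by have := ht.1; positivity) (by positivity) (lintegral_ofReal_mul_le (by positivity) h3)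
    (lintegral_ofReal_mul_le (c := σ / a) (by norm_num)
      (h1.trans (ENNReal.ofReal_le_ofReal h2)))).trans (ENNReal.ofReal_le_ofReal ?_)
  have : 6 * σ / a = 6 * (σ / a) := by ring
  linarith

lemma lintegral_integral_sq_le [SFinite P] (hX : ModeProcess P a σ T m X) (ha : 0 < a)
    (hσ : 0 ≤ σ) (hm : 0 ≤ m) (hT : 0 ≤ T) :
    ∫⁻ ω, ENNReal.ofReal (∫ s in 0..T, X s ω ^ 2) ∂P ≤
      ENNReal.ofReal ((3 / 2 * m + 6 * T * σ) / a) := by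
  refine (lintegral_ofReal_integral_le hX.toContProcess.pow_two (fun s ω => sq_nonneg _) hT
    (h := fun t => 3 * Real.exp (-(2 * a * t)) * m + 6 * σ / a) (by fun_prop)
    (fun s _ => by positivity) fun s hs => hX.lintegral_sq_le ha hσ hm hs).trans
      (ENNReal.ofReal_le_ofReal ?_)
  have hd : ∀ s ∈ Set.uIcc 0 T, HasDerivAt
      (fun s => -(3 * m / (2 * a)) * Real.exp (-(2 * a * s)) + 6 * σ / a * s)
      (3 * Real.exp (-(2 * a * s)) * m + 6 * σ / a) s := by
    intro s _
    have h1 : HasDerivAt (fun s : ℝ => -(2 * a * s)) (-(2 * a)) s := by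
      simpa using! ((hasDerivAt_id s).const_mul (2 * a)).neg
    refine ((h1.exp.const_mul (-(3 * m / (2 * a)))).add
      ((hasDerivAt_id s).const_mul (6 * σ / a))).congr_deriv ?_
    field_simp
  rw [intervalIntegral.integral_eq_sub_of_hasDerivAt hd
    (Continuous.intervalIntegrable (by fun_prop) _ _)]
  have h1 : 0 ≤ 3 * m / (2 * a) * Real.exp (-(2 * a * T)) := by positivity
  have h2 : (3 / 2 * m + 6 * T * σ) / a = 3 * m / (2 * a) + 6 * σ / a * T := by field_simp
  simp only [mul_zero, neg_zero, Real.exp_zero, mul_one, add_zero]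
  linarith

end ModeProcess

/-! ### The quadrature of the noise -/

/-- The error of the right-endpoint rule on one cell of length `h`. -/
def cellError (Y : ℝ → ℝ) (p h : ℝ) (l : ℕ) : ℝ :=
  ∫ s in (p + l * h)..(p + (l + 1 : ℕ) * h), (Y s - Y (p + (l + 1 : ℕ) * h))

lemma sum_cellError {Y : ℝ → ℝ} (hY : Continuous Y) (p h : ℝ) (M : ℕ) :
    ∑ l ∈ Finset.range M, cellError Y p h l =
      (∫ s in p..(p + M * h), Y s) - h * ∑ l ∈ Finset.Icc 1 M, Y (p + l * h) := by
  induction M with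
  | zero => simp
  | succ M ih =>
    rw [Finset.sum_range_succ, ih, Finset.sum_Icc_succ_top (by omega), cellError,
      intervalIntegral.integral_sub (hY.intervalIntegrable _ _) (by simp),
      intervalIntegral.integral_const,
      ← intervalIntegral.integral_add_adjacent_intervals (a := p) (b := p + M * h)
        (c := p + (M + 1 : ℕ) * h) (hY.intervalIntegrable _ _) (hY.intervalIntegrable _ _)]
    simp only [smul_eq_mul]
    push_cast
    ring

namespace ModeProcess

variable {a σ T m : ℝ} {X : ℝ → Ω → ℝ}

lemma measurable_cellError (hX : ModeProcess P a σ T m X) (p h : ℝ) (l : ℕ) :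
    Measurable fun ω => cellError (drive a fun s => X s ω) p h l :=
  ((hX.toContProcess.drive a).sub
    (ContProcess.const ((hX.toContProcess.drive a).measurable _))).measurable_integral _ _

variable [IsFiniteMeasure P] {p h : ℝ} {l M : ℕ}

lemma cell_mem (hp : 0 ≤ p) (hh : 0 ≤ h) (hT : p + (l + 1 : ℕ) * h ≤ T) {s : ℝ}
    (hs : s ∈ Set.Icc (p + l * h) (p + (l + 1 : ℕ) * h)) : s ∈ Set.Icc 0 T :=
  ⟨le_trans (by positivity) hs.1, hs.2.trans hT⟩

lemma cell_le (hh : 0 ≤ h) : p + l * h ≤ p + (l + 1 : ℕ) * h := by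
  push_cast; nlinarith

lemma lintegral_cellError_sq (hX : ModeProcess P a σ T m X) (hσ : 0 ≤ σ) (hp : 0 ≤ p)
    (hh : 0 ≤ h) (hT : p + (l + 1 : ℕ) * h ≤ T) :
    ∫⁻ ω, ENNReal.ofReal (cellError (drive a fun s => X s ω) p h l ^ 2) ∂P ≤
      ENNReal.ofReal (σ * h ^ 3) := by
  have hY := hX.toContProcess.drive a
  have hle := cell_le (p := p) (l := l) hh
  have hlen : p + (l + 1 : ℕ) * h - (p + l * h) = h := by push_cast; ring
  refine (lintegral_mono fun ω => ENNReal.ofReal_le_ofReal (sq_integral_le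
    (((hY.continuous ω).sub continuous_const)) hle)).trans ?_
  rw [hlen]
  have h1 := lintegral_ofReal_integral_le (P := P)
    (hY.sub (ContProcess.const (hY.measurable (p + (l + 1 : ℕ) * h)))).pow_two
    (fun s ω => sq_nonneg _) hle (h := fun _ => σ * h) continuous_const
    (fun s _ => by positivity) fun s hs => by
      refine (hX.lintegral_sub_sq' (cell_mem hp hh hT hs)
        (cell_mem hp hh hT ⟨hle, le_rfl⟩) hs.2).le.trans (ENNReal.ofReal_le_ofReal ?_)
      gcongr
      linarith [hs.1]
  refine (lintegral_ofReal_mul_le hh h1).trans (le_of_eq ?_)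
  rw [intervalIntegral.integral_const, hlen, smul_eq_mul]
  ring_nf

lemma memLp_cellError (hX : ModeProcess P a σ T m X) (hσ : 0 ≤ σ) (hp : 0 ≤ p)
    (hh : 0 ≤ h) (hT : p + (l + 1 : ℕ) * h ≤ T) :
    MemLp (fun ω => cellError (drive a fun s => X s ω) p h l) 2 P :=
  memLp_two_of_lintegral_le (hX.measurable_cellError p h l).aestronglyMeasurable
    (hX.lintegral_cellError_sq hσ hp hh hT)

/-- A cell error is a time integral of increments, so by Fubini orthogonality to each increment
passes to the integral. -/
lemma integral_mul_cellError (hX : ModeProcess P a σ T m X) (hσ : 0 ≤ σ) (hp : 0 ≤ p)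
    (hh : 0 ≤ h) (hT : p + (l + 1 : ℕ) * h ≤ T) {G : Ω → ℝ} (hG : MemLp G 2 P)
    (h0 : ∀ s ∈ Set.Icc (p + l * h) (p + (l + 1 : ℕ) * h), ∫ ω, G ω *
      (drive a (fun s => X s ω) s - drive a (fun s => X s ω) (p + (l + 1 : ℕ) * h)) ∂P = 0) :
    ∫ ω, G ω * cellError (drive a fun s => X s ω) p h l ∂P = 0 := by
  have hY := hX.toContProcess.drive a
  have hle := cell_le (p := p) (l := l) hh
  have h1 := integral_mul_intervalIntegral (P := P)
    (hY.sub (ContProcess.const (hY.measurable (p + (l + 1 : ℕ) * h)))) hG (K := σ * h) hle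
    fun s hs => by
      refine (hX.lintegral_sub_sq' (cell_mem hp hh hT hs)
        (cell_mem hp hh hT ⟨hle, le_rfl⟩) hs.2).le.trans (ENNReal.ofReal_le_ofReal ?_)
      gcongr
      have := hs.1
      push_cast
      linarith
  refine h1.trans ?_
  rw [intervalIntegral.integral_congr (g := fun _ => 0)]
  · simp
  · intro s hs
    rw [Set.uIcc_of_le hle] at hs
    exact h0 s hs

/-- The three claims need a common induction: orthogonality to later increments kills the cross term
when the next cell is added, so second moments add instead of norms. Only the covariance is used,
not independence. -/
lemma sum_cellError_spec (hX : ModeProcess P a σ T m X) (hσ : 0 ≤ σ) (hp : 0 ≤ p)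
    (hh : 0 ≤ h) (hT : p + M * h ≤ T) :
    MemLp (fun ω => ∑ l ∈ Finset.range M, cellError (drive a fun s => X s ω) p h l) 2 P ∧
    (∀ r ∈ Set.Icc (p + M * h) T, ∀ s ∈ Set.Icc (p + M * h) T,
      ∫ ω, (∑ l ∈ Finset.range M, cellError (drive a fun s => X s ω) p h l) *
        (drive a (fun s => X s ω) s - drive a (fun s => X s ω) r) ∂P = 0) ∧
    ∫ ω, (∑ l ∈ Finset.range M, cellError (drive a fun s => X s ω) p h l) ^ 2 ∂P ≤
      M * (σ * h ^ 3) := by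
  induction M with
  | zero => simp
  | succ M ih =>
    have hle := cell_le (p := p) (l := M) hh
    obtain ⟨ih1, ih2, ih3⟩ := ih (hle.trans hT)
    have hc := hX.memLp_cellError hσ hp hh hT
    have hend : p + (M + 1 : ℕ) * h ∈ Set.Icc (p + M * h) T := ⟨hle, hT⟩
    simp_rw [Finset.sum_range_succ]
    refine ⟨ih1.add hc, fun r hr s hs => ?_, ?_⟩
    · have hr0 : r ∈ Set.Icc 0 T := ⟨le_trans (by positivity) hr.1, hr.2⟩
      have hs0 : s ∈ Set.Icc 0 T := ⟨le_trans (by positivity) hs.1, hs.2⟩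
      have hD : MemLp (fun ω => drive a (fun s => X s ω) s - drive a (fun s => X s ω) r) 2 P :=
        (hX.memLp s hs0).sub (hX.memLp r hr0)
      simp_rw [add_mul]
      have i1 := ih1.integrable_mul hD
      have i2 := hc.integrable_mul hD
      simp only [Pi.mul_def] at i1 i2
      rw [integral_add i1 i2, ih2 r ⟨hle.trans hr.1, hr.2⟩ s ⟨hle.trans hs.1, hs.2⟩, zero_add]
      simp_rw [mul_comm (cellError _ _ _ _)]
      refine hX.integral_mul_cellError hσ hp hh hT hD fun v hv => ?_
      have hv0 := cell_mem hp hh hT hv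
      rw [hX.integral_sub_mul_sub hs0 hr0 hv0 (cell_mem hp hh hT ⟨hle, le_rfl⟩),
        min_eq_right (hv.2.trans hs.1), min_eq_right hs.1, min_eq_right (hv.2.trans hr.1),
        min_eq_right hr.1]
      ring
    · have h1 : ∫ ω, (∑ l ∈ Finset.range M, cellError (drive a fun s => X s ω) p h l) *
          cellError (drive a fun s => X s ω) p h M ∂P = 0 :=
        hX.integral_mul_cellError hσ hp hh hT ih1 fun s hs =>
          ih2 _ hend s ⟨hs.1, hs.2.trans hT⟩
      have h2 : ∫ ω, cellError (drive a fun s => X s ω) p h M ^ 2 ∂P ≤ σ * h ^ 3 := by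
        have h3 := hX.lintegral_cellError_sq hσ hp hh hT
        rwa [← ofReal_integral_eq_lintegral_ofReal hc.integrable_sq
          (Filter.Eventually.of_forall fun ω => sq_nonneg _),
          ENNReal.ofReal_le_ofReal_iff (by positivity)] at h3
      have i1 := ih1.integrable_sq
      have i2 := (ih1.integrable_mul hc).const_mul 2
      have i3 := hc.integrable_sq
      simp only [Pi.mul_apply] at i2
      have e : ∀ ω, (∑ l ∈ Finset.range M, cellError (drive a fun s => X s ω) p h l +
          cellError (drive a fun s => X s ω) p h M) ^ 2 =
          (∑ l ∈ Finset.range M, cellError (drive a fun s => X s ω) p h l) ^ 2 +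
          2 * ((∑ l ∈ Finset.range M, cellError (drive a fun s => X s ω) p h l) *
          cellError (drive a fun s => X s ω) p h M) +
          cellError (drive a fun s => X s ω) p h M ^ 2 := fun ω => by ring
      have i12 := i1.add i2
      simp only [Pi.add_def] at i12
      simp_rw [e]
      rw [integral_add i12 i3, integral_add i1 i2, integral_const_mul, h1]
      push_cast
      linarith

/-- The mean square error of the quadrature of the noise. -/
lemma lintegral_quadrature_sq (hX : ModeProcess P a σ T m X) (hσ : 0 ≤ σ) (hp : 0 ≤ p)
    {τ : ℝ} (hτ : 0 ≤ τ) (hM : M ≠ 0) (hT : p + τ ≤ T) :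
    ∫⁻ ω, ENNReal.ofReal (((∫ s in p..(p + τ), drive a (fun s => X s ω) s) -
      τ * ((M : ℝ)⁻¹ * ∑ l ∈ Finset.Icc 1 M, drive a (fun s => X s ω) (p + l * (τ / M)))) ^ 2) ∂P ≤
      ENNReal.ofReal (τ * (σ * (τ / M) ^ 2)) := by
  have hM' : (M : ℝ) ≠ 0 := Nat.cast_ne_zero.2 hM
  have hMτ : (M : ℝ) * (τ / M) = τ := by field_simp
  obtain ⟨h1, -, h3⟩ := hX.sum_cellError_spec (M := M) (h := τ / M) hσ hp (by positivity)
    (by rwa [hMτ])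
  have e : ∀ ω, (∫ s in p..(p + τ), drive a (fun s => X s ω) s) -
      τ * ((M : ℝ)⁻¹ * ∑ l ∈ Finset.Icc 1 M, drive a (fun s => X s ω) (p + l * (τ / M))) =
      ∑ l ∈ Finset.range M, cellError (drive a fun s => X s ω) p (τ / M) l := fun ω => by
    rw [sum_cellError (continuous_drive (hX.continuous ω)), hMτ, ← mul_assoc, div_eq_mul_inv]
  simp_rw [e]
  rw [← ofReal_integral_eq_lintegral_ofReal h1.integrable_sq
    (Filter.Eventually.of_forall fun ω => sq_nonneg _)]
  refine ENNReal.ofReal_le_ofReal (h3.trans (le_of_eq ?_))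
  linear_combination (σ * (τ / M) ^ 2) * hMτ

end ModeProcess

/-! ### The error in one mode -/

namespace ModeProcess

variable {a σ T m : ℝ} {X : ℝ → Ω → ℝ} [IsFiniteMeasure P]

lemma grid_mem {N n : ℕ} {τ : ℝ} (hτ : 0 ≤ τ) (hN : N * τ = T) (hn : n ≤ N) :
    (n : ℝ) * τ ∈ Set.Icc 0 T := by
  refine ⟨by positivity, ?_⟩
  rw [← hN]
  have : (n : ℝ) ≤ N := Nat.cast_le.2 hn
  gcongr

/-- Suitable constants approximate the paths on the cells of the coarse grid. -/
lemma exists_integral_sq_sub_le (hX : ModeProcess P a σ T m X) (ha : 0 < a) (hσ : 0 ≤ σ)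
    (hm : 0 ≤ m) {τ : ℝ} (hτ : 0 < τ) {N : ℕ} (hN : N * τ = T) :
    ∃ c : ℕ → Ω → ℝ, (∀ n, Measurable (c n)) ∧
      ∫⁻ ω, ENNReal.ofReal (∑ n ∈ Finset.range N,
        ∫ s in (n * τ)..((n + 1 : ℕ) * τ), (X s ω - c n ω) ^ 2) ∂P ≤
      ENNReal.ofReal (τ * (3 * m + 14 * T * σ)) := by
  have hT : 0 ≤ T := by rw [← hN]; positivity
  have hS := hX.lintegral_integral_sq_le ha hσ hm hT
  have hsum : ∀ ω, ∑ n ∈ Finset.range N, ∫ s in (n * τ)..((n + 1 : ℕ) * τ), X s ω ^ 2 =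
      ∫ s in 0..T, X s ω ^ 2 := fun ω => by
    have := intervalIntegral.sum_integral_adjacent_intervals (μ := volume)
      (f := fun s => X s ω ^ 2) (a := fun n : ℕ => (n : ℝ) * τ) (n := N)
      fun k _ => (((hX.continuous ω).pow 2).intervalIntegrable _ _)
    simpa [hN] using this
  have hlen : ∀ n : ℕ, ((n + 1 : ℕ) : ℝ) * τ - n * τ = τ := fun n => by push_cast; ring
  have hle : ∀ n : ℕ, (n : ℝ) * τ ≤ ((n + 1 : ℕ) : ℝ) * τ := fun n => by linarith [hlen n]
  -- For `a τ ≥ 1` the bound `O(1/a)` on `E ∫ x²` is already `O(τ)`, so zero serves. For `a τ ≤ 1`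
  -- the left endpoint value serves: the drift contributes `a τ · τ (3m + 12 T σ)` and the noise `2
  -- T σ τ`, whence `14 = 12 + 2`.
  rcases le_total 1 (a * τ) with h1 | h1
  · refine ⟨fun _ _ => 0, fun _ => measurable_const, ?_⟩
    simp_rw [sub_zero, hsum]
    refine hS.trans (ENNReal.ofReal_le_ofReal ?_)
    rw [div_le_iff₀ ha]
    have h2 : 0 ≤ 3 * m + 14 * T * σ := by positivity
    have h3 := mul_le_mul_of_nonneg_right h1 h2
    have h4 : 0 ≤ T * σ := by positivity
    linarith
  · have hY := hX.toContProcess.drive a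
    refine ⟨fun n => X (n * τ), fun n => hX.measurable _, ?_⟩
    have hb : ∀ ω, ∑ n ∈ Finset.range N, ∫ s in (n * τ)..((n + 1 : ℕ) * τ),
        (X s ω - X (n * τ) ω) ^ 2 ≤ 2 * a ^ 2 * τ ^ 2 * (∫ s in 0..T, X s ω ^ 2) +
        2 * ∑ n ∈ Finset.range N, ∫ s in (n * τ)..((n + 1 : ℕ) * τ),
          (drive a (fun s => X s ω) s - drive a (fun s => X s ω) (n * τ)) ^ 2 := fun ω => by
      rw [← hsum, Finset.mul_sum, Finset.mul_sum, ← Finset.sum_add_distrib]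
      refine Finset.sum_le_sum fun n _ => ?_
      have := integral_sq_sub_le (a := a) (hX.continuous ω) (hle n)
      rwa [hlen] at this
    have h3 : ∫⁻ ω, ENNReal.ofReal (∑ n ∈ Finset.range N, ∫ s in (n * τ)..((n + 1 : ℕ) * τ),
        (drive a (fun s => X s ω) s - drive a (fun s => X s ω) (n * τ)) ^ 2) ∂P ≤
        ENNReal.ofReal (N * (σ * τ * τ)) := by
      refine lintegral_ofReal_sum_le
        (fun n _ => (hY.sub (ContProcess.const (hY.measurable _))).pow_two.measurable_integral _ _)
        (by positivity) fun n hn => ?_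
      refine (lintegral_ofReal_integral_le
        (hY.sub (ContProcess.const (hY.measurable _))).pow_two (fun s ω => sq_nonneg _) (hle n)
        (h := fun _ => σ * τ) continuous_const (fun s _ => by positivity) fun s hs => ?_).trans
          (le_of_eq ?_)
      · have h4 := grid_mem hτ.le hN hn.le
        have h5 := grid_mem hτ.le hN (Nat.succ_le_of_lt hn)
        refine (hX.lintegral_sub_sq h4 ⟨h4.1.trans hs.1, hs.2.trans h5.2⟩ hs.1).le.trans
          (ENNReal.ofReal_le_ofReal ?_)
        gcongr
        linarith [hs.2, hlen n]
      · rw [intervalIntegral.integral_const, hlen, smul_eq_mul, mul_comm]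
    refine (lintegral_mono fun ω => ENNReal.ofReal_le_ofReal (hb ω)).trans ?_
    refine (lintegral_ofReal_add_le
      ((hX.toContProcess.pow_two.measurable_integral 0 T).const_mul _).aemeasurable
      (by positivity) (by positivity) (lintegral_ofReal_mul_le (by positivity) hS)
      (lintegral_ofReal_mul_le zero_le_two h3)).trans (ENNReal.ofReal_le_ofReal ?_)
    have h4 : (N : ℝ) * (σ * τ * τ) = T * σ * τ := by rw [← hN]; ring
    have h5 : 2 * a ^ 2 * τ ^ 2 * ((3 / 2 * m + 6 * T * σ) / a) =
        a * τ * (τ * (3 * m + 12 * T * σ)) := by field_simp; ring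
    have h6 : a * τ * (τ * (3 * m + 12 * T * σ)) ≤ 1 * (τ * (3 * m + 12 * T * σ)) := by gcongr
    rw [h4, h5]
    linarith

/-- The error of the Crank–Nicolson scheme in one mode. -/
lemma lintegral_error_le (hX : ModeProcess P a σ T m X) (ha : 0 ≤ a) (hσ : 0 ≤ σ)
    (hm : 0 ≤ m) {τ : ℝ} (hτ : 0 < τ) {N M : ℕ} (hN : N * τ = T) (hM : 1 ≤ M * τ)
    {V : ℕ → Ω → ℝ} (hV0 : V 0 =ᵐ[P] X 0)
    (hV : ∀ n < N, ∀ᵐ ω ∂P, V (n + 1) ω - V n ω + a * τ * ((V n ω + V (n + 1) ω) / 2 +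
      ((M : ℝ)⁻¹ * ∑ l ∈ Finset.Icc 1 M, drive a (fun s => X s ω) (n * τ + l * (τ / M)) -
        (drive a (fun s => X s ω) ((n + 1 : ℕ) * τ) + drive a (fun s => X s ω) (n * τ)) / 2)) =
      drive a (fun s => X s ω) ((n + 1 : ℕ) * τ) - drive a (fun s => X s ω) (n * τ))
    {n : ℕ} (hn : n ≤ N) :
    ∫⁻ ω, ENNReal.ofReal ((X (n * τ) ω - V n ω) ^ 2 + a * τ * ∑ k ∈ Finset.range n,
      ((X (k * τ) ω + X ((k + 1 : ℕ) * τ) ω) / 2 - (V k ω + V (k + 1) ω) / 2) ^ 2) ∂P ≤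
    ENNReal.ofReal (τ ^ 3 * (a ^ 3 * (3 / 2 * m + 7 * T * σ) + 2 * a * T * σ)) := by
  set I : ℕ → Ω → ℝ := fun n ω =>
    (M : ℝ)⁻¹ * ∑ l ∈ Finset.Icc 1 M, drive a (fun s => X s ω) (n * τ + l * (τ / M)) with hI
  have hT : 0 ≤ T := by rw [← hN]; positivity
  have hpath : ∀ᵐ ω ∂P, (X (n * τ) ω - V n ω) ^ 2 + a * τ * ∑ k ∈ Finset.range n,
      ((X (k * τ) ω + X ((k + 1 : ℕ) * τ) ω) / 2 - (V k ω + V (k + 1) ω) / 2) ^ 2 ≤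
      a / τ * ∑ k ∈ Finset.range n,
        localError a (fun s => X s ω) (k * τ) ((k + 1 : ℕ) * τ) (I k ω) ^ 2 := by
    have hV' := ae_all_iff.2 fun n => Filter.eventually_imp_distrib_left.2 (hV n)
    filter_upwards [hV0, hV'] with ω h0 h1
    exact energy_estimate (V := fun n => V n ω) (I := fun n => I n ω) (hX.continuous ω) ha hτ
      h0 h1 hn
  -- At frequency zero the scheme is exact, since the defect enters with the factor `a`; the moment
  -- bounds divide by `a` and are avoided.
  rcases ha.eq_or_lt with rfl | ha'
  · refine (lintegral_mono_ae (g := fun _ => 0) ?_).trans (by simp)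
    filter_upwards [hpath] with ω hω
    exact (ENNReal.ofReal_eq_zero.2 (hω.trans (by simp))).le
  have hlen : ∀ n : ℕ, ((n + 1 : ℕ) : ℝ) * τ - n * τ = τ := fun n => by push_cast; ring
  have hlen' : ∀ n : ℕ, ((n + 1 : ℕ) : ℝ) * τ = n * τ + τ := fun n => by push_cast; ring
  have hle : ∀ n : ℕ, (n : ℝ) * τ ≤ ((n + 1 : ℕ) : ℝ) * τ := fun n => by linarith [hlen n]
  have hY := hX.toContProcess.drive a
  have hM0 : M ≠ 0 := by rintro rfl; norm_num at hM
  -- The requirement `M ≥ 1/τ` acts here: each step then has quadrature error at most `σ τ⁵` in mean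
  -- square, and `a/τ` times twice the sum over `T/τ` steps is `2 a T σ τ³`.
  have hMτ : τ / M ≤ τ ^ 2 := by
    have : (0 : ℝ) < M := by positivity
    rw [div_le_iff₀ this]
    nlinarith
  obtain ⟨c, hcm, hc⟩ := hX.exists_integral_sq_sub_le ha' hσ hm hτ hN
  set D : ℕ → Ω → ℝ := fun k ω => (∫ s in (k * τ)..(k * τ + τ), drive a (fun s => X s ω) s) -
    τ * I k ω with hD
  have hDm : ∀ k, Measurable (D k) := fun k => (hY.measurable_integral _ _).sub
    (((Finset.measurable_fun_sum _ fun l _ => hY.measurable _).const_mul _).const_mul _)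
  have hDN : ∫⁻ ω, ENNReal.ofReal (∑ k ∈ Finset.range N, D k ω ^ 2) ∂P ≤
      ENNReal.ofReal (N * (τ * (σ * (τ ^ 2) ^ 2))) := by
    refine lintegral_ofReal_sum_le (fun k _ => (hDm k).pow_const 2) (by positivity) fun k hk => ?_
    have h1 := grid_mem hτ.le hN (Nat.succ_le_of_lt hk)
    refine (hX.lintegral_quadrature_sq hσ (grid_mem hτ.le hN hk.le).1 hτ.le hM0
      (by rw [← hlen']; exact h1.2)).trans (ENNReal.ofReal_le_ofReal ?_)
    gcongr
  have hfin : ∀ᵐ ω ∂P, (X (n * τ) ω - V n ω) ^ 2 + a * τ * ∑ k ∈ Finset.range n,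
      ((X (k * τ) ω + X ((k + 1 : ℕ) * τ) ω) / 2 - (V k ω + V (k + 1) ω) / 2) ^ 2 ≤
      a / τ * (a ^ 2 * τ ^ 3 / 2 * (∑ k ∈ Finset.range N,
        ∫ s in (k * τ)..((k + 1 : ℕ) * τ), (X s ω - c k ω) ^ 2) +
        2 * ∑ k ∈ Finset.range N, D k ω ^ 2) := by
    filter_upwards [hpath] with ω hω
    refine hω.trans (mul_le_mul_of_nonneg_left ?_ (by positivity))
    refine (Finset.sum_le_sum_of_subset_of_nonneg
      (Finset.range_subset_range.2 hn) fun _ _ _ => sq_nonneg _).trans ?_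
    rw [Finset.mul_sum, Finset.mul_sum, ← Finset.sum_add_distrib]
    refine Finset.sum_le_sum fun k _ => ?_
    have := sq_localError_le (a := a) (hX.continuous ω) (hle k) (c k ω) (I k ω)
    rw [hlen] at this
    simpa only [hD, hlen'] using this
  refine (lintegral_mono_ae (hfin.mono fun ω h => ENNReal.ofReal_le_ofReal h)).trans ?_
  have hcs : Measurable fun ω => ∑ k ∈ Finset.range N,
      ∫ s in (k * τ)..((k + 1 : ℕ) * τ), (X s ω - c k ω) ^ 2 :=
    Finset.measurable_fun_sum _ fun k _ =>
      (hX.toContProcess.sub (ContProcess.const (hcm k))).pow_two.measurable_integral _ _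
  refine (lintegral_ofReal_mul_le (by positivity) (lintegral_ofReal_add_le
    (hcs.const_mul _).aemeasurable (by positivity) (by positivity)
    (lintegral_ofReal_mul_le (by positivity) hc)
    (lintegral_ofReal_mul_le zero_le_two hDN))).trans (ENNReal.ofReal_le_ofReal (le_of_eq ?_))
  rw [← hN]
  field_simp
  ring

end ModeProcess

end ModeEquation

/-! ### Reduction to the modes -/

section ModeSums

/-- The index set of the solenoidal eigenfields. -/
abbrev ModeIndex : Type := (Fin 2 → ℤ) × (Fin 2 × Bool)

/-- The solenoidal eigenfield with a given index. -/
def modeAt (i : ModeIndex) : LTwo Vec := mode i.1 i.2.1 i.2.2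

/-- The weight `w` covers `1`, `eigen` and `eigen³`, that is, the `L²` error, the gradient error and
the data. -/
lemma tsum_mul_energy_eq {v : LTwo Vec} (hv : FreqOrthogonal v) (w : (Fin 2 → ℤ) → ℝ)
    (hw : ∀ ξ, 0 ≤ w ξ) : ∑' ξ, ENNReal.ofReal (w ξ * energy ξ v) =
      ∑' i : ModeIndex, ENNReal.ofReal (w i.1) * ENNReal.ofReal (inner ℝ v (modeAt i) ^ 2) := by
  rw [ENNReal.tsum_prod']
  congr 1
  funext ξ
  rw [tsum_fintype, energy_eq_sum_mode hv, ENNReal.ofReal_mul (hw ξ),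
    ENNReal.ofReal_sum_of_nonneg fun _ _ => sq_nonneg _, Finset.mul_sum]
  rfl

lemma enorm_sq_eq_tsum_modeAt {v : LTwo Vec} (hv : FreqOrthogonal v) :
    ‖v‖ₑ ^ 2 = ∑' i : ModeIndex, ENNReal.ofReal (inner ℝ v (modeAt i) ^ 2) := by
  rw [enorm_sq_eq_tsum]
  simpa using tsum_mul_energy_eq hv (fun _ => 1) fun _ => zero_le_one

lemma MemSobolev.sum {α : Type*} {s : Finset α} {f : α → LTwo Vec}
    (h : ∀ i ∈ s, MemSobolev 1 (f i)) : MemSobolev 1 (∑ i ∈ s, f i) := by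
  classical
  induction s using Finset.induction_on with
  | empty => simpa using (memSobolev_one_waveField 0 false (0 : Vec)).smul 0
  | insert i s hi ih =>
    rw [Finset.sum_insert hi]
    exact (h i (Finset.mem_insert_self i s)).add
      (ih fun j hj => h j (Finset.mem_insert_of_mem hj))

lemma continuous_energy (ξ : Fin 2 → ℤ) : Continuous fun v : LTwo Vec => energy ξ v := by
  simp_rw [energy_eq_sum_inner]
  fun_prop

lemma aemeasurable_tsum_eigen_mul_energy {Z : Type*} {mZ : MeasurableSpace Z} {μ : Measure Z}
    {f : Z → LTwo Vec} (hf : AEStronglyMeasurable f μ) :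
    AEMeasurable (fun z => ∑' ξ, ENNReal.ofReal (eigen ξ * energy ξ (f z))) μ :=
  AEMeasurable.tsum fun ξ =>
    (((continuous_energy ξ).comp_aestronglyMeasurable hf).aemeasurable.const_mul _).ennreal_ofReal

end ModeSums

/-! ### Solution and iterates tested with the eigenfields -/

section Assembly

variable {Ω : Type*} {mΩ : MeasurableSpace Ω} {P : Measure Ω}
  {𝓕 : Filtration ℝ≥0 mΩ} {H : Type*} [NormedAddCommGroup H] [InnerProductSpace ℝ H]
  {ι : Type*} {e : HilbertBasis ι ℝ H} {W : ι → ℝ≥0 → Ω → ℝ} {Φ : H →L[ℝ] LTwo Vec}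
  {u₀ : Ω → LTwo Vec} {ν : ℝ} {T : ℝ≥0} {u : ℝ≥0 → Ω → LTwo Vec}

/-- The coefficients of a solution of the Stokes system in one mode. -/
lemma IsStokesSolution.exists_modeProcess [IsProbabilityMeasure P]
    (hu : IsStokesSolution 𝓕 P e Φ W ν T u₀ u)
    (hW : IsCylindricalWiener 𝓕 P W) (hΦ : Summable fun k => ‖Φ (e k)‖ ^ 2) (i : ModeIndex)
    {m : ℝ} (hm : ∫⁻ ω, ENNReal.ofReal (inner ℝ (u₀ ω) (modeAt i) ^ 2) ∂P ≤ ENNReal.ofReal m) :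
    ∃ X : ℝ → Ω → ℝ, ModeProcess P (ν * eigen i.1) (noiseVar e Φ (modeAt i)) T m X ∧
      (∀ᵐ ω ∂P, ∀ t ≤ T, X t ω = inner ℝ (u t ω) (modeAt i)) ∧
      ∀ t ≤ T, ∀ᵐ ω ∂P, drive (ν * eigen i.1) (fun s => X s ω) t =
        inner ℝ (noise P e Φ W t ω) (modeAt i) := by
  obtain ⟨G, hGc, hGm, hG⟩ := exists_measurable_superset_of_null hu.continuous_paths
  have hGae : ∀ᵐ ω ∂P, ω ∈ Gᶜ := measure_eq_zero_iff_ae_notMem.1 hG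
  have hGcont : ∀ ω ∈ Gᶜ, Continuous fun s : ℝ => u (min s.toNNReal T) ω := fun ω hω => by
    have h : ContinuousOn (fun t => u t ω) (Set.Icc 0 T) := by
      by_contra h
      exact hω (hGc h)
    exact h.comp_continuous (by fun_prop) fun s => ⟨zero_le, min_le_right _ _⟩
  -- Clamping time to `[0, T]` and discarding a measurable null set makes every path continuous on
  -- the whole line while keeping `X s` measurable.
  set X : ℝ → Ω → ℝ := fun s =>
    Gᶜ.indicator fun ω => inner ℝ (u (min s.toNNReal T) ω) (modeAt i) with hX
  have hXu : ∀ ω ∈ Gᶜ, ∀ t ≤ T, X t ω = inner ℝ (u t ω) (modeAt i) := fun ω hω t ht => by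
    simp [hX, Set.indicator_of_mem hω, ht]
  have hXc : ContProcess X := by
    refine ⟨fun ω => ?_, fun s => ?_⟩
    · by_cases hω : ω ∈ Gᶜ
      · simp only [hX, Set.indicator_of_mem hω]
        exact (hGcont ω hω).inner continuous_const
      · simp only [hX, Set.indicator_of_notMem hω]
        exact continuous_const
    · refine Measurable.indicator ?_ hGm.compl
      exact (((hu.adapted _ (min_le_right _ _)).mono (𝓕.le _)).inner
        stronglyMeasurable_const).measurable
  have hdrive : ∀ t ≤ T, ∀ᵐ ω ∂P, drive (ν * eigen i.1) (fun s => X s ω) t =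
      inner ℝ (noise P e Φ W t ω) (modeAt i) := fun t ht => by
    filter_upwards [hGae, hu.mem_L2_V, hu.initial,
      hu.momentum t ht (modeAt i) (memV_mode _ _ _)] with ω h1 h2 h3 h4
    -- The solution lies in `H¹` only for almost every time, which is enough to replace the gradient
    -- pairing by the eigenvalue under the time integral.
    have hfin : ∫⁻ s in Set.Icc (0 : ℝ) T, ∑' ξ, ENNReal.ofReal
        (eigen ξ * energy ξ (u (min s.toNNReal T) ω)) ≠ ∞ := by
      refine ne_top_of_le_ne_top h2.ne (setLIntegral_mono' measurableSet_Icc fun s hs => ?_)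
      rw [min_eq_left (Real.toNNReal_le_iff_le_coe.2 hs.2)]
      simpa using tsum_le_sobolevSq 1 (u s.toNNReal ω)
    have hae := ae_lt_top'
      (aemeasurable_tsum_eigen_mul_energy (hGcont ω h1).aestronglyMeasurable) hfin
    rw [ae_restrict_iff' measurableSet_Icc] at hae
    have hint : ∫ s in (0 : ℝ)..t, gradInner (u s.toNNReal ω) (modeAt i) =
        ∫ s in (0 : ℝ)..t, eigen i.1 * X s ω := by
      refine intervalIntegral.integral_congr_ae ?_
      filter_upwards [hae] with s hs hst
      rw [Set.uIoc_of_le t.coe_nonneg] at hst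
      have hsT : s ≤ T := hst.2.trans (NNReal.coe_le_coe.2 ht)
      have h5 := hs ⟨hst.1.le, hsT⟩
      have h6 : s.toNNReal ≤ T := Real.toNNReal_le_iff_le_coe.2 hsT
      rw [min_eq_left h6] at h5
      have h7 := hXu ω h1 _ h6
      rw [Real.coe_toNNReal _ hst.1.le] at h7
      rw [h7]
      exact gradInner_mode (memSobolev_one_of_tsum_ne_top h5.ne) _ _ _
    rw [hint, intervalIntegral.integral_const_mul] at h4
    have h0 := hXu ω h1 0 zero_le
    rw [NNReal.coe_zero, h3] at h0
    rw [drive, hXu ω h1 t ht, h0, h4]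
    ring
  have hdrive' : ∀ t ∈ Set.Icc (0 : ℝ) T, (fun ω => drive (ν * eigen i.1) (fun s => X s ω) t) =ᵐ[P]
      fun ω => inner ℝ (noise P e Φ W t.toNNReal ω) (modeAt i) := fun t ht => by
    have := hdrive t.toNNReal (Real.toNNReal_le_iff_le_coe.2 ht.2)
    rwa [Real.coe_toNNReal _ ht.1] at this
  refine ⟨X, ⟨hXc, ?_, fun t ht => ?_, fun s hs t ht => ?_⟩, ?_, hdrive⟩
  · refine (lintegral_congr_ae ?_).trans_le hm
    filter_upwards [hGae, hu.initial] with ω h1 h2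
    have := hXu ω h1 0 zero_le
    rw [NNReal.coe_zero] at this
    rw [this, h2]
  · exact (memLp_inner_noise t.toNNReal (modeAt i)).ae_eq (hdrive' t ht).symm
  · have h1 := hW.integral_inner_noise_mul hΦ s.toNNReal t.toNNReal (modeAt i)
    refine Eq.trans (integral_congr_ae ?_) (h1.trans ?_)
    · filter_upwards [hdrive' s hs, hdrive' t ht] with ω h2 h3
      rw [h2, h3]
    · rw [NNReal.coe_min, Real.coe_toNNReal _ hs.1, Real.coe_toNNReal _ ht.1]
  · filter_upwards [hGae] with ω hω using hXu ω hω

lemma IsCylindricalWiener.memSobolev_quadratureCorrection [IsProbabilityMeasure P]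
    [Countable ι]
    (hW : IsCylindricalWiener 𝓕 P W) (hΦ : ∑' k, sobolevSq 3 (Φ (e k)) < ∞) (τ : ℝ≥0)
    (M n : ℕ) : ∀ᵐ ω ∂P, MemSobolev 1 (quadratureCorrection P e Φ W τ M n ω) := by
  have h1 : ∀ᵐ ω ∂P, ∀ l : ℕ, MemSobolev 1 (noise P e Φ W (n * τ + l * (τ / M)) ω) :=
    ae_all_iff.2 fun l => hW.memSobolev_noise hΦ _
  filter_upwards [h1, hW.memSobolev_noise hΦ ((n + 1 : ℕ) * τ),
    hW.memSobolev_noise hΦ (n * τ)] with ω h2 h3 h4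
  rw [quadratureCorrection, sub_eq_add_neg, ← neg_smul]
  exact ((MemSobolev.sum fun l _ => h2 l).smul _).add ((h3.add h4).smul _)

lemma memSobolev_initial (hu₀ : AEStronglyMeasurable u₀ P)
    (hmom : ∫⁻ ω, sobolevSq 3 (u₀ ω) ∂P < ∞) : ∀ᵐ ω ∂P, MemSobolev 1 (u₀ ω) := by
  have h1 : ∫⁻ ω, ∑' ξ, ENNReal.ofReal (eigen ξ * energy ξ (u₀ ω)) ∂P ≠ ∞ := by
    refine ne_top_of_le_ne_top ?_ (lintegral_mono fun ω => tsum_eigen_mul_energy_le (u₀ ω))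
    rw [lintegral_const_mul' _ _ (by simp)]
    exact ENNReal.mul_ne_top (by simp) hmom.ne
  filter_upwards [ae_lt_top' (aemeasurable_tsum_eigen_mul_energy hu₀) h1] with ω hω
  exact memSobolev_one_of_tsum_ne_top hω.ne

variable {τ : ℝ≥0} {N M : ℕ} {U : ℕ → Ω → LTwo Vec} {p : ℕ → Ω → LTwo ℝ}

lemma IsCrankNicolson.memSobolev (hU : IsCrankNicolson P e Φ W ν τ N M u₀ U p)
    (h0 : ∀ᵐ ω ∂P, MemSobolev 1 (u₀ ω)) {n : ℕ} (hn : n ≤ N) :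
    ∀ᵐ ω ∂P, MemSobolev 1 (U n ω) := by
  cases n with
  | zero =>
    filter_upwards [h0, hU.initial] with ω h1 h2
    rwa [h2]
  | succ n => exact hU.mem_H1 n hn

lemma IsCrankNicolson.freqOrthogonal (hU : IsCrankNicolson P e Φ W ν τ N M u₀ U p)
    (h0 : ∀ᵐ ω ∂P, IsSolenoidal (u₀ ω)) {n : ℕ} (hn : n ≤ N) :
    ∀ᵐ ω ∂P, FreqOrthogonal (U n ω) := by
  cases n with
  | zero =>
    filter_upwards [h0, hU.initial] with ω h1 h2
    rw [h2]
    exact h1.freqOrthogonal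
  | succ n =>
    filter_upwards [hU.mem_H1 n hn, hU.incompressible n hn] with ω h1 h2
    exact freqOrthogonal_of_incompressible h1 h2

/-- The Crank–Nicolson scheme in one mode. -/
lemma IsCrankNicolson.mode_eq [IsProbabilityMeasure P] [Countable ι]
    (hU : IsCrankNicolson P e Φ W ν τ N M u₀ U p)
    (hW : IsCylindricalWiener 𝓕 P W) (hΦ : ∑' k, sobolevSq 3 (Φ (e k)) < ∞)
    (h0 : ∀ᵐ ω ∂P, MemSobolev 1 (u₀ ω)) (hτ : 0 < τ) {n : ℕ} (hn : n < N) (i : ModeIndex) :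
    ∀ᵐ ω ∂P, inner ℝ (U (n + 1) ω) (modeAt i) - inner ℝ (U n ω) (modeAt i) +
      ν * eigen i.1 * τ * ((inner ℝ (U n ω) (modeAt i) + inner ℝ (U (n + 1) ω) (modeAt i)) / 2 +
        ((M : ℝ)⁻¹ * ∑ l ∈ Finset.Icc 1 M,
            inner ℝ (noise P e Φ W (n * τ + l * (τ / M)) ω) (modeAt i) -
          (inner ℝ (noise P e Φ W ((n + 1 : ℕ) * τ) ω) (modeAt i) +
            inner ℝ (noise P e Φ W (n * τ) ω) (modeAt i)) / 2)) =
      inner ℝ (noise P e Φ W ((n + 1 : ℕ) * τ) ω) (modeAt i) -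
        inner ℝ (noise P e Φ W (n * τ) ω) (modeAt i) := by
  filter_upwards [hU.momentum n hn, hU.memSobolev h0 hn.le, hU.mem_H1 n hn,
    hW.memSobolev_quadratureCorrection hΦ τ M n] with ω h1 h2 h3 h4
  have h5 := memV_mode i.1 i.2.1 i.2.2
  have h6 := h1 (modeAt i) h5.1
  have h7 : gradInner ((2⁻¹ : ℝ) • (U (n + 1) ω + U n ω) + quadratureCorrection P e Φ W τ M n ω)
      (modeAt i) = _ := gradInner_mode (((h3.add h2).smul _).add h4) _ _ _
  have h8 : divergence (modeAt i) = 0 := h5.2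
  rw [h7, h8, inner_zero_right, ← modeAt, quadratureCorrection, noiseQuadrature] at h6
  simp only [inner_add_left, inner_sub_left, real_inner_smul_left, sum_inner] at h6
  have hτ' : (τ : ℝ) * (τ : ℝ)⁻¹ = 1 := mul_inv_cancel₀ (NNReal.coe_ne_zero.2 hτ.ne')
  linear_combination (τ : ℝ) * h6 - (inner ℝ (U (n + 1) ω) (modeAt i) -
    inner ℝ (U n ω) (modeAt i) - inner ℝ (noise P e Φ W ((n + 1 : ℕ) * τ) ω) (modeAt i) +
        inner ℝ (noise P e Φ W (n * τ) ω) (modeAt i)) * hτ'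

end Assembly

/-! ### The sum over all modes -/

section ErrorEstimate

variable {Ω : Type*} {mΩ : MeasurableSpace Ω} {P : Measure Ω}
  {𝓕 : Filtration ℝ≥0 mΩ} {H : Type*} [NormedAddCommGroup H] [InnerProductSpace ℝ H]
  {ι : Type*} {e : HilbertBasis ι ℝ H} {W : ι → ℝ≥0 → Ω → ℝ}
  {Φ : H →L[ℝ] LTwo Vec} {u₀ : Ω → LTwo Vec} {ν : ℝ} {T τ : ℝ≥0} {u : ℝ≥0 → Ω → LTwo Vec}
  {N M : ℕ} {U : ℕ → Ω → LTwo Vec} {p : ℕ → Ω → LTwo ℝ}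

/-- No measurability of the iterates is assumed. Each scalar step is implicit with the positive
factor `1 + a τ / 2`, so solving it expresses the new coefficient through measurable ones. -/
lemma IsCrankNicolson.aemeasurable_inner_modeAt [IsProbabilityMeasure P] [Countable ι]
    (hU : IsCrankNicolson P e Φ W ν τ N M u₀ U p)
    (hW : IsCylindricalWiener 𝓕 P W) (hΦ : ∑' k, sobolevSq 3 (Φ (e k)) < ∞)
    (h0 : ∀ᵐ ω ∂P, MemSobolev 1 (u₀ ω)) (hu₀ : AEStronglyMeasurable u₀ P) (hν : 0 < ν)
    (hτ : 0 < τ) (i : ModeIndex) {n : ℕ} (hn : n ≤ N) :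
    AEMeasurable (fun ω => inner ℝ (U n ω) (modeAt i)) P := by
  induction n with
  | zero =>
    refine (hu₀.inner (aestronglyMeasurable_const (b := modeAt i))).aemeasurable.congr ?_
    filter_upwards [hU.initial] with ω hω
    rw [hω]
  | succ n ih =>
    have hV := ih (Nat.le_of_succ_le hn)
    have hB : ∀ t, AEMeasurable (fun ω => inner ℝ (noise P e Φ W t ω) (modeAt i)) P := fun t =>
      (memLp_inner_noise t _).1.aemeasurable
    set J : Ω → ℝ := fun ω => (M : ℝ)⁻¹ * ∑ l ∈ Finset.Icc 1 M,
            inner ℝ (noise P e Φ W (n * τ + l * (τ / M)) ω) (modeAt i) -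
          (inner ℝ (noise P e Φ W ((n + 1 : ℕ) * τ) ω) (modeAt i) +
            inner ℝ (noise P e Φ W (n * τ) ω) (modeAt i)) / 2 with hJ
    have hJm : AEMeasurable J P :=
      ((Finset.aemeasurable_fun_sum _ fun l _ => hB _).const_mul _).sub
        (((hB _).add (hB _)).div_const 2)
    have hc : 0 < 1 + ν * eigen i.1 * τ / 2 := by
      have := eigen_nonneg i.1
      positivity
    have hm : AEMeasurable (fun ω => (1 + ν * eigen i.1 * τ / 2)⁻¹ *
        ((inner ℝ (noise P e Φ W ((n + 1 : ℕ) * τ) ω) (modeAt i) -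
          inner ℝ (noise P e Φ W (n * τ) ω) (modeAt i)) +
          (1 - ν * eigen i.1 * τ / 2) * inner ℝ (U n ω) (modeAt i) -
            ν * eigen i.1 * τ * J ω)) P :=
      ((((hB _).sub (hB _)).add (hV.const_mul _)).sub (hJm.const_mul _)).const_mul _
    refine hm.congr ?_
    filter_upwards [hU.mode_eq hW hΦ h0 hτ hn i] with ω hω
    rw [inv_mul_eq_div, div_eq_iff hc.ne']
    simp only [hJ]
    linear_combination -hω

/-- The error estimate in one mode. -/
lemma IsCrankNicolson.lintegral_mode_error_le [IsProbabilityMeasure P] [Countable ι]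
    (hU : IsCrankNicolson P e Φ W ν τ N M u₀ U p)
    (hW : IsCylindricalWiener 𝓕 P W) (hΦ : ∑' k, sobolevSq 3 (Φ (e k)) < ∞)
    (h0 : ∀ᵐ ω ∂P, MemSobolev 1 (u₀ ω)) (hν : 0 < ν) (hτ : 0 < τ) (hN : N * τ = T)
    (hM : 1 ≤ M * τ) (hu : IsStokesSolution 𝓕 P e Φ W ν T u₀ u) (i : ModeIndex) {m : ℝ}
    (hm0 : 0 ≤ m)
    (hm : ∫⁻ ω, ENNReal.ofReal (inner ℝ (u₀ ω) (modeAt i) ^ 2) ∂P ≤ ENNReal.ofReal m)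
    {n : ℕ} (hn : n ≤ N) :
    ∫⁻ ω, ENNReal.ofReal (inner ℝ (u (n * τ) ω - U n ω) (modeAt i) ^ 2 +
      ν * eigen i.1 * τ * ∑ k ∈ Finset.range n, inner ℝ ((2⁻¹ : ℝ) •
        (u (k * τ) ω + u ((k + 1 : ℕ) * τ) ω) - (2⁻¹ : ℝ) • (U k ω + U (k + 1) ω))
          (modeAt i) ^ 2) ∂P ≤
    ENNReal.ofReal (τ ^ 3 * ((ν * eigen i.1) ^ 3 * (3 / 2 * m + 7 * T * noiseVar e Φ (modeAt i)) +
      2 * (ν * eigen i.1) * T * noiseVar e Φ (modeAt i))) := by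
  obtain ⟨X, hX, hXu, hXd⟩ := hu.exists_modeProcess hW (summable_norm_sq_of_tsum_sobolevSq hΦ) i hm
  have hgrid : ∀ k ≤ N, (k : ℝ≥0) * τ ≤ T := fun k hk => by
    rw [← hN]
    gcongr
  have key := hX.lintegral_error_le (mul_nonneg hν.le (eigen_nonneg i.1)) (noiseVar_nonneg _) hm0
    (NNReal.coe_pos.2 hτ) (by rw [← hN]; push_cast; rfl) (M := M) (by exact_mod_cast hM)
    (V := fun n ω => inner ℝ (U n ω) (modeAt i)) ?_ ?_ hn
  · refine (lintegral_congr_ae ?_).trans_le key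
    filter_upwards [hXu] with ω hω
    have h1 : ∀ k ≤ N, X (k * τ) ω = inner ℝ (u (k * τ) ω) (modeAt i) := fun k hk => by
      rw [← hω _ (hgrid k hk)]
      push_cast
      rfl
    have h2 : ∀ k ∈ Finset.range n, inner ℝ ((2⁻¹ : ℝ) •
        (u (k * τ) ω + u ((k + 1 : ℕ) * τ) ω) - (2⁻¹ : ℝ) • (U k ω + U (k + 1) ω))
          (modeAt i) ^ 2 = ((X (k * τ) ω + X ((k + 1 : ℕ) * τ) ω) / 2 -
          (inner ℝ (U k ω) (modeAt i) + inner ℝ (U (k + 1) ω) (modeAt i)) / 2) ^ 2 :=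
      fun k hk => by
        have hkN : k < N := (Finset.mem_range.1 hk).trans_le hn
        rw [h1 k hkN.le, h1 (k + 1) hkN]
        simp only [inner_sub_left, real_inner_smul_left, inner_add_left]
        ring
    rw [h1 n hn, inner_sub_left, Finset.sum_congr rfl h2]
  · filter_upwards [hXu, hU.initial, hu.initial] with ω h1 h2 h3
    have := h1 0 zero_le
    rw [NNReal.coe_zero] at this
    rw [this, h2, h3]
  · intro k hk
    have hfine : ∀ᵐ ω ∂P, ∀ l : ℕ, l ∈ Finset.Icc 1 M →
        drive (ν * eigen i.1) (fun s => X s ω) (k * τ + l * (τ / M)) =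
          inner ℝ (noise P e Φ W (k * τ + l * (τ / M)) ω) (modeAt i) := by
      refine ae_all_iff.2 fun l => Filter.eventually_imp_distrib_left.2 fun hl => ?_
      have hl' := Finset.mem_Icc.1 hl
      -- All fine nodes of a step lie within that coarse cell, hence in `[0, T]`, where the drive is
      -- the noise.
      have hle : (k : ℝ≥0) * τ + l * (τ / M) ≤ T := by
        refine le_trans ?_ (hgrid (k + 1) hk)
        have hM0 : (0 : ℝ≥0) < M := by
          have : 0 < M := lt_of_lt_of_le Nat.one_pos (hl'.1.trans hl'.2)
          exact_mod_cast this
        have h1 : (l : ℝ≥0) * (τ / M) ≤ M * (τ / M) := by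
          have : (l : ℝ≥0) ≤ M := Nat.cast_le.2 hl'.2
          gcongr
        rw [mul_div_cancel₀ _ hM0.ne'] at h1
        push_cast
        rw [add_mul, one_mul]
        gcongr
      have := hXd _ hle
      push_cast at this
      exact this
    have h1 := hXd _ (hgrid k hk.le)
    have h2 := hXd _ (hgrid (k + 1) hk)
    simp only [NNReal.coe_mul, NNReal.coe_natCast] at h1 h2
    filter_upwards [hfine, h1, h2, hU.mode_eq hW hΦ h0 hτ hk i] with ω h3 h4 h5 h6
    rw [h4, h5, Finset.sum_congr rfl h3]
    exact h6

/-- Exchanging the sums over modes and over `k` turns the variances of the modes into weighted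
energies of the columns of `Φ`, which are solenoidal. -/
lemma tsum_noiseVar_eq (hΦ : ∑' k, sobolevSq 3 (Φ (e k)) < ∞) (hΦd : ∀ x, IsSolenoidal (Φ x))
    (w : (Fin 2 → ℤ) → ℝ) (hw : ∀ ξ, 0 ≤ w ξ) :
    ∑' i : ModeIndex, ENNReal.ofReal (w i.1) * ENNReal.ofReal (noiseVar e Φ (modeAt i)) =
      ∑' k, ∑' ξ, ENNReal.ofReal (w ξ * energy ξ (Φ (e k))) := by
  simp_rw [ofReal_noiseVar (summable_norm_sq_of_tsum_sobolevSq hΦ), ← ENNReal.tsum_mul_left,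
    tsum_mul_energy_eq (hΦd _).freqOrthogonal w hw]
  exact ENNReal.tsum_comm

lemma tsum_lintegral_inner_modeAt (hu₀ : AEStronglyMeasurable u₀ P)
    (hdiv : ∀ᵐ ω ∂P, IsSolenoidal (u₀ ω)) (w : (Fin 2 → ℤ) → ℝ) (hw : ∀ ξ, 0 ≤ w ξ) :
    ∑' i : ModeIndex, ENNReal.ofReal (w i.1) *
        ∫⁻ ω, ENNReal.ofReal (inner ℝ (u₀ ω) (modeAt i) ^ 2) ∂P =
      ∫⁻ ω, ∑' ξ, ENNReal.ofReal (w ξ * energy ξ (u₀ ω)) ∂P := by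
  have hm : ∀ i : ModeIndex,
      AEMeasurable (fun ω => ENNReal.ofReal (inner ℝ (u₀ ω) (modeAt i) ^ 2)) P := fun i =>
    ((hu₀.inner aestronglyMeasurable_const).aemeasurable.pow_const 2).ennreal_ofReal
  have h1 : ∫⁻ ω, ∑' ξ, ENNReal.ofReal (w ξ * energy ξ (u₀ ω)) ∂P =
      ∫⁻ ω, ∑' i : ModeIndex, ENNReal.ofReal (w i.1) *
        ENNReal.ofReal (inner ℝ (u₀ ω) (modeAt i) ^ 2) ∂P := by
    refine lintegral_congr_ae ?_
    filter_upwards [hdiv] with ω hω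
    exact tsum_mul_energy_eq hω.freqOrthogonal w hw
  rw [h1, lintegral_tsum fun i => (hm i).const_mul _]
  simp_rw [lintegral_const_mul'' _ (hm _)]

/-- The sum over all modes of the bounds for the error in one mode. -/
lemma tsum_mode_bound_le (hΦ : ∑' k, sobolevSq 3 (Φ (e k)) < ∞)
    (hΦd : ∀ x, IsSolenoidal (Φ x)) (hu₀ : AEStronglyMeasurable u₀ P)
    (hdiv : ∀ᵐ ω ∂P, IsSolenoidal (u₀ ω)) (hν : 0 ≤ ν) {m : ModeIndex → ℝ} (hm0 : ∀ i, 0 ≤ m i)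
    (hm : ∀ i, ENNReal.ofReal (m i) = ∫⁻ ω, ENNReal.ofReal (inner ℝ (u₀ ω) (modeAt i) ^ 2) ∂P) :
    ∑' i : ModeIndex, ENNReal.ofReal (τ ^ 3 * ((ν * eigen i.1) ^ 3 *
        (3 / 2 * m i + 7 * T * noiseVar e Φ (modeAt i)) +
        2 * (ν * eigen i.1) * T * noiseVar e Φ (modeAt i))) ≤
      ENNReal.ofReal (τ ^ 3) * (ENNReal.ofReal (3 / 2 * ν ^ 3) * ∫⁻ ω, sobolevSq 3 (u₀ ω) ∂P +
        ENNReal.ofReal (7 * T * ν ^ 3 + 4 * ν * T) * ∑' k, sobolevSq 3 (Φ (e k))) := by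
  have heig := fun ξ => eigen_nonneg ξ
  have hs := fun i => noiseVar_nonneg (e := e) (Φ := Φ) (modeAt i)
  have e1 : ∀ i : ModeIndex, ENNReal.ofReal (τ ^ 3 * ((ν * eigen i.1) ^ 3 *
        (3 / 2 * m i + 7 * T * noiseVar e Φ (modeAt i)) +
        2 * (ν * eigen i.1) * T * noiseVar e Φ (modeAt i))) =
      ENNReal.ofReal (τ ^ 3) * (ENNReal.ofReal (3 / 2 * ν ^ 3) *
        (ENNReal.ofReal (eigen i.1 ^ 3) * ∫⁻ ω, ENNReal.ofReal (inner ℝ (u₀ ω) (modeAt i) ^ 2) ∂P) +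
      (ENNReal.ofReal (7 * T * ν ^ 3) *
        (ENNReal.ofReal (eigen i.1 ^ 3) * ENNReal.ofReal (noiseVar e Φ (modeAt i))) +
      ENNReal.ofReal (2 * ν * T) *
        (ENNReal.ofReal (eigen i.1) * ENNReal.ofReal (noiseVar e Φ (modeAt i))))) := fun i => by
    have := heig i.1
    have := hs i
    have := hm0 i
    rw [← hm, ← ENNReal.ofReal_mul (by positivity), ← ENNReal.ofReal_mul (by positivity),
      ← ENNReal.ofReal_mul (by positivity), ← ENNReal.ofReal_mul (by positivity),
      ← ENNReal.ofReal_mul (by positivity), ← ENNReal.ofReal_mul (by positivity),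
      ← ENNReal.ofReal_add (by positivity) (by positivity),
      ← ENNReal.ofReal_add (by positivity) (by positivity), ← ENNReal.ofReal_mul (by positivity)]
    ring_nf
  simp_rw [e1, ENNReal.tsum_mul_left, ENNReal.tsum_add, ENNReal.tsum_mul_left]
  rw [tsum_lintegral_inner_modeAt hu₀ hdiv (fun ξ => eigen ξ ^ 3) fun ξ => pow_nonneg (heig ξ) 3,
    tsum_noiseVar_eq hΦ hΦd (fun ξ => eigen ξ ^ 3) fun ξ => pow_nonneg (heig ξ) 3,
    tsum_noiseVar_eq hΦ hΦd eigen heig]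
  have h2 : ∑' k, ∑' ξ, ENNReal.ofReal (eigen ξ * energy ξ (Φ (e k))) ≤
      2 * ∑' k, sobolevSq 3 (Φ (e k)) := by
    rw [← ENNReal.tsum_mul_left]
    exact ENNReal.tsum_le_tsum fun k => tsum_eigen_mul_energy_le _
  -- The coefficient `4` is `2 · 2`, the second factor being the cost of bounding weight `eigen` by
  -- the `H³` norm.
  have h3 : ENNReal.ofReal (7 * T * ν ^ 3 + 4 * ν * T) =
      ENNReal.ofReal (7 * T * ν ^ 3) + ENNReal.ofReal (2 * ν * T) * 2 := by
    rw [← ENNReal.ofReal_ofNat 2, ← ENNReal.ofReal_mul (by positivity),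
      ← ENNReal.ofReal_add (by positivity) (by positivity)]
    ring_nf
  rw [h3, add_mul, mul_assoc (ENNReal.ofReal (2 * ν * T))]
  gcongr
  · exact tsum_le_sobolevSq 3 _
  · exact tsum_le_sobolevSq 3 _

end ErrorEstimate

end StochasticStokes

end

open StochasticStokes
-- The error estimate for the full fields
theorem theorem4p1
    {Ω : Type*} {mΩ : MeasurableSpace Ω} (P : Measure Ω) [IsProbabilityMeasure P]
    (𝓕 : Filtration ℝ≥0 mΩ)
    {H : Type*} [NormedAddCommGroup H] [InnerProductSpace ℝ H] [CompleteSpace H]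
    {ι : Type*} [Countable ι] (e : HilbertBasis ι ℝ H)
    (W : ι → ℝ≥0 → Ω → ℝ) (hW : IsCylindricalWiener 𝓕 P W)
    (Φ : H →L[ℝ] LTwo Vec) (hΦ_div : ∀ x, IsSolenoidal (Φ x))
    (hΦ_HS : ∑' k, sobolevSq 3 (Φ (e k)) < ∞)
    (u₀ : Ω → LTwo Vec) (hu₀_meas : StronglyMeasurable[𝓕 0] u₀)
    (hu₀_div : ∀ᵐ ω ∂P, IsSolenoidal (u₀ ω))
    (hu₀_mom : ∫⁻ ω, sobolevSq 3 (u₀ ω) ∂P < ∞)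
    (ν : ℝ) (hν : 0 < ν) (T : ℝ≥0) (hT : 0 < T) :
    ∃ C : ℝ, 0 < C ∧
      ∀ u : ℝ≥0 → Ω → LTwo Vec, IsStokesSolution 𝓕 P e Φ W ν T u₀ u →
      ∀ (N M : ℕ) (τ : ℝ≥0), N * τ = T → 1 ≤ M * τ →
      ∀ (U : ℕ → Ω → LTwo Vec) (p : ℕ → Ω → LTwo ℝ),
        IsCrankNicolson P e Φ W ν τ N M u₀ U p →
        (∀ n ≤ N, ∫⁻ ω, ‖u (n * τ) ω - U n ω‖ₑ ^ 2 ∂P ≤ ENNReal.ofReal (C * τ ^ 3)) ∧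
        ENNReal.ofReal (ν * τ) * ∑ n ∈ Finset.range N,
            ∫⁻ ω, gradSq ((2⁻¹ : ℝ) • (u (n * τ) ω + u ((n + 1 : ℕ) * τ) ω)
              - (2⁻¹ : ℝ) • (U n ω + U (n + 1) ω)) ∂P
          ≤ ENNReal.ofReal (C * τ ^ 3) := by
  have hu₀ : AEStronglyMeasurable u₀ P := (hu₀_meas.mono (𝓕.le 0)).aestronglyMeasurable
  set K : ℝ≥0∞ := ENNReal.ofReal (3 / 2 * ν ^ 3) * ∫⁻ ω, sobolevSq 3 (u₀ ω) ∂P +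
    ENNReal.ofReal (7 * T * ν ^ 3 + 4 * ν * T) * ∑' k, sobolevSq 3 (Φ (e k)) with hK
  have hKfin : K ≠ ∞ := ENNReal.add_ne_top.2
    ⟨ENNReal.mul_ne_top ENNReal.ofReal_ne_top hu₀_mom.ne,
      ENNReal.mul_ne_top ENNReal.ofReal_ne_top hΦ_HS.ne⟩
  -- `K` depends only on the data, `ν` and `T`; adding one makes the constant positive even for zero
  -- data.
  refine ⟨K.toReal + 1, by positivity, fun u hu N M τ hN hM U p hU => ?_⟩
  have hτ : 0 < τ := by
    refine pos_iff_ne_zero.2 fun h => hT.ne' ?_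
    rw [← hN, h, mul_zero]
  have h0 := memSobolev_initial hu₀ hu₀_mom
  have hgrid : ∀ k ≤ N, (k : ℝ≥0) * τ ≤ T := fun k hk => by
    rw [← hN]
    gcongr
  set m : ModeIndex → ℝ := fun i =>
    (∫⁻ ω, ENNReal.ofReal (inner ℝ (u₀ ω) (modeAt i) ^ 2) ∂P).toReal with hmdef
  have hm : ∀ i, ENNReal.ofReal (m i) =
      ∫⁻ ω, ENNReal.ofReal (inner ℝ (u₀ ω) (modeAt i) ^ 2) ∂P := fun i => by
    refine ENNReal.ofReal_toReal (ne_top_of_le_ne_top hu₀_mom.ne (lintegral_mono_ae ?_))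
    filter_upwards [hu₀_div] with ω hω
    refine le_trans ?_ (enorm_sq_le_sobolevSq 3 (u₀ ω))
    rw [enorm_sq_eq_tsum_modeAt hω.freqOrthogonal]
    exact ENNReal.le_tsum i
  have hm0 : ∀ i, 0 ≤ m i := fun i => ENNReal.toReal_nonneg
  have hmode := fun i (n : ℕ) (hn : n ≤ N) =>
    hU.lintegral_mode_error_le hW hΦ_HS h0 hν hτ hN hM hu i (hm0 i) (hm i).ge hn
  have htotal := tsum_mode_bound_le (τ := τ) (T := T) hΦ_HS hΦ_div hu₀ hu₀_div hν.le hm0 hm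
  have hC : ENNReal.ofReal ((τ : ℝ) ^ 3) * K ≤ ENNReal.ofReal ((K.toReal + 1) * τ ^ 3) := by
    rw [mul_comm, ENNReal.ofReal_mul (by positivity)]
    gcongr
    rw [ENNReal.le_ofReal_iff_toReal_le hKfin (by positivity)]
    linarith
  have hb := htotal.trans hC
  have hVm : ∀ n ≤ N, ∀ i, AEMeasurable (fun ω => inner ℝ (U n ω) (modeAt i)) P :=
    fun n hn i => hU.aemeasurable_inner_modeAt hW hΦ_HS h0 hu₀ hν hτ i hn
  have hum : ∀ n ≤ N, ∀ i, AEMeasurable (fun ω => inner ℝ (u (n * τ) ω) (modeAt i)) P :=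
    fun n hn i => (((hu.adapted _ (hgrid n hn)).mono (𝓕.le _)).inner
      (stronglyMeasurable_const (b := modeAt i))).measurable.aemeasurable
  have hUf : ∀ n ≤ N, ∀ᵐ ω ∂P, FreqOrthogonal (U n ω) := fun n hn =>
    hU.freqOrthogonal hu₀_div hn
  have huf : ∀ n ≤ N, ∀ᵐ ω ∂P, FreqOrthogonal (u (n * τ) ω) := fun n hn => by
    filter_upwards [hu.solenoidal] with ω hω using (hω _ (hgrid n hn)).freqOrthogonal
  refine ⟨fun n hn => ?_, ?_⟩
  · have h1 : ∫⁻ ω, ‖u (n * τ) ω - U n ω‖ₑ ^ 2 ∂P =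
        ∫⁻ ω, ∑' i, ENNReal.ofReal (inner ℝ (u (n * τ) ω - U n ω) (modeAt i) ^ 2) ∂P := by
      refine lintegral_congr_ae ?_
      filter_upwards [huf n hn, hUf n hn] with ω h1 h2
      exact enorm_sq_eq_tsum_modeAt (h1.sub h2)
    rw [h1, lintegral_tsum fun i => ?_]
    · refine le_trans (ENNReal.tsum_le_tsum fun i => le_trans (lintegral_mono fun ω => ?_)
        (hmode i n hn)) hb
      refine ENNReal.ofReal_le_ofReal (le_add_of_nonneg_right ?_)
      have := eigen_nonneg i.1
      exact mul_nonneg (by positivity) (Finset.sum_nonneg fun _ _ => sq_nonneg _)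
    · simp_rw [inner_sub_left]
      exact (((hum n hn i).sub (hVm n hn i)).pow_const 2).ennreal_ofReal
  · set D : ℕ → Ω → LTwo Vec := fun n ω => (2⁻¹ : ℝ) • (u (n * τ) ω + u ((n + 1 : ℕ) * τ) ω) -
      (2⁻¹ : ℝ) • (U n ω + U (n + 1) ω) with hD
    have hDm : ∀ n < N, ∀ i, AEMeasurable
        (fun ω => ENNReal.ofReal (inner ℝ (D n ω) (modeAt i) ^ 2)) P := fun n hn i => by
      simp_rw [hD, inner_sub_left, real_inner_smul_left, inner_add_left]
      exact (((((hum n hn.le i).add (hum (n + 1) hn i)).const_mul _).sub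
        (((hVm n hn.le i).add (hVm (n + 1) hn i)).const_mul _)).pow_const 2).ennreal_ofReal
    have h1 : ∀ n ∈ Finset.range N, ∫⁻ ω, gradSq (D n ω) ∂P ≤ ∑' i : ModeIndex,
        ENNReal.ofReal (eigen i.1) *
          ∫⁻ ω, ENNReal.ofReal (inner ℝ (D n ω) (modeAt i) ^ 2) ∂P := fun n hn => by
      have hn' := Finset.mem_range.1 hn
      simp_rw [← lintegral_const_mul'' _ (hDm n hn' _)]
      rw [← lintegral_tsum fun i => (hDm n hn' i).const_mul _]
      refine lintegral_mono_ae ?_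
      filter_upwards [huf n hn'.le, huf (n + 1) hn', hUf n hn'.le, hUf (n + 1) hn']
        with ω h1 h2 h3 h4
      refine (gradSq_le (D n ω)).trans (le_of_eq ?_)
      exact tsum_mul_energy_eq (((h1.add h2).smul _).sub ((h3.add h4).smul _)) eigen eigen_nonneg
    refine (mul_le_mul_right (Finset.sum_le_sum h1) _).trans ?_
    rw [← Summable.tsum_finsetSum fun i _ => ENNReal.summable, ← ENNReal.tsum_mul_left]
    -- The dissipation part of the estimate at the final step `N`, with the squared endpoint error
    -- discarded, bounds the whole sum over time steps in each mode.
    refine le_trans (ENNReal.tsum_le_tsum fun i => ?_) hb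
    have heig := eigen_nonneg i.1
    refine le_trans ?_ ((lintegral_mono fun ω => ENNReal.ofReal_le_ofReal
      (le_add_of_nonneg_left (sq_nonneg _))).trans (hmode i N le_rfl))
    simp_rw [ENNReal.ofReal_mul (show 0 ≤ ν * eigen i.1 * τ by positivity),
      ENNReal.ofReal_sum_of_nonneg fun _ _ => sq_nonneg (_ : ℝ)]
    rw [lintegral_const_mul' _ _ ENNReal.ofReal_ne_top,
      lintegral_finsetSum' _ fun n hn => hDm n (Finset.mem_range.1 hn) i, ← Finset.mul_sum,
      ← mul_assoc, ← ENNReal.ofReal_mul (by positivity)]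
    refine le_of_eq ?_
    congr 2
    ring
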